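/- **Setting.** Let $\mathcal C$ be a bicategory ($*$ is horizontal composition of arrows and 2-cells, $\circ$ is vertical composition). A pair of arrows $(i\colon A\to X,\ p\colon Y\to B)$ has the *lifting property* if (LP1) every invertible 2-cell $\gamma\colon p*a\Rightarrow b*i$ has a *filler* $(f,\lambda,\rho)$, that is, an arrow $f\colon X\to Y$ and invertible 2-cells $\lambda\colon a\Rightarrow f*i$, $\rho\colon p*f\Rightarrow b$ with $\rho*i\circ p*\lambda=\gamma$; and (LP2) for fillers $(f_k,\lambda_k,\rho_k)$ of $\gamma_k\colon p*a_k\Rightarrow b_k*i$ $(k=1,2)$ and 2-cells $\alpha\colon a_1\Rightarrow a_2$, $\beta\colon b_1\Rightarrow b_2$ with $\gamma_2\circ p*\alpha=\beta*i\circ\gamma_1$ there is $\delta\colon f_1\Rightarrow f_2$ with $\lambda_2\circ\alpha=\delta*i\circ\lambda_1$ and $\rho_2\circ p*\delta=\beta\circ\rho_1$. Let $\mathcal C$ be a *model bicategory*: it has three classes of arrows (fibrations, cofibrations, weak equivalences) such that: $\mathcal C$ has initial and terminal objects, pullbacks and pushouts (in the bicategorical sense); a cofibration and a fibration, one of which is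 a weak equivalence, have the lifting property; every arrow is isomorphic to a composite $p*i$ with $i$ a cofibration and $p$ a fibration, and one may require $i$, or alternatively $p$, to be a weak equivalence; fibrations (cofibrations) are closed under composition, pullback (pushout) and invertible 2-cells, and contain the equivalences; pullbacks of trivial fibrations and pushouts of trivial cofibrations are weak equivalences; if $g*f\cong h$ and two of $f,g,h$ are weak equivalences, so is the third; and equivalences are weak equivalences. (*Trivial* means: also a weak equivalence.) An object $X$ is *cofibrant* if $0\to X$ is a cofibration. **Homotopies.** A *$\sigma$-cylinder* for $X$ consists of arrows $d_0,d_1\colon X\to W$, $x\colon X\to Z$, a weak equivalence $s\colon W\to Z$ and invertible 2-cells $\alpha_k\colon s*d_k\Rightarrow x$ ($k=0,1$). It is a *$w$-cylinder* if $Z=X$, $x=\mathrm{id}_X$ and the induced arrow $\binom{d_0}{d_1}\colon X\amalg X\to W$ is a cofibration. A *left $\sigma$-homotopy* $H$ from $f$ to $g$ ($f,g\colon X\to Y$) is a $\sigma$-cylinder for $X$ with an arrow $h\colon W\to Y$ and 2-cells $\eta\colon f\Rightarrow h*d_0$, $\varepsilon\colon h*d_1\Rightarrow g$. Below, $H\colon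 f\rightsquigarrow g$ means that $H$ is a *left $w$-homotopy with invertible cells*: a left $\sigma$-homotopy whose cylinder is a $w$-cylinder and whose $\eta,\varepsilon$ are invertible. An arrow $s$ of a bicategory $\mathcal D$ is a *quasiequivalence* if all functors $s_*\colon\mathcal D(V,X)\to\mathcal D(V,Y)$ and $s^*\colon\mathcal D(Y,V)\to\mathcal D(X,V)$ are full and faithful. If a 2-functor $F\colon\mathcal C\to\mathcal D$ maps weak equivalences to quasiequivalences, a left $\sigma$-homotopy $H$ determines the 2-cell $\widehat{FH}=F\varepsilon\circ(Fh*\widehat{FC})\circ F\eta\colon Ff\Rightarrow Fg$, where $\widehat{FC}\colon Fd_0\Rightarrow Fd_1$ is the unique 2-cell with $Fs*\widehat{FC}=F(\alpha_1^{-1}\circ\alpha_0)$. Let $\mathcal Ho(\mathcal C,\mathcal W)$ be the bicategory with the objects and arrows of $\mathcal C$, whose 2-cells are the classes of finite composable sequences of left $\sigma$-homotopies, two sequences being identified if their (composite) images under all such $F$ agree. Vertical composition is juxtaposition, and composition of classes with arrows is given by composing homotopies with arrows. We write $[H]$ for the class of $H$. A 2-cell $\mu$ of $\mathcal C$ also denotes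 its image in $\mathcal Ho(\mathcal C,\mathcal W)$ (the class of a $\sigma$-homotopy $I^\mu$ with $\widehat{FI^\mu}=F\mu$ for all such $F$). Associators and unitors are omitted. **Cofibrant replacement.** Let $Q$ be a cofibrant replacement for $\mathcal C$: a choice, for each object $X$, of a cofibrant object $QX$ and a trivial fibration $p_X\colon QX\to X$; for each arrow $f\colon X\to Y$, of an arrow $Qf\colon QX\to QY$ and an invertible 2-cell $\rho_f\colon p_Y*Qf\Rightarrow f*p_X$; and for each 2-cell $\mu\colon f\Rightarrow g$, of a 2-cell $Q\mu\colon Qf\Rightarrow Qg$ with $p_Y*Q\mu=\rho_g^{-1}\circ\mu*p_X\circ\rho_f$. No functoriality is assumed. **Lemma.** All equations below are between 2-cells of $\mathcal Ho(\mathcal C,\mathcal W)$. 1. For $f\colon X\to X$ and $H\colon \mathrm{id}_X\rightsquigarrow f$ there exists $\xi_QH\colon \mathrm{id}_{QX}\rightsquigarrow Qf$ such that $p_X*[\xi_QH]=\rho_f^{-1}\circ[H]*p_X$. 2. For $f\colon X\to Y$, $g\colon Y\to Z$, $l\colon X\to Z$ and $H\colon g*f\rightsquigarrow l$ there exists $\phi_QH\colon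 Qg*Qf\rightsquigarrow Ql$ such that $p_Z*[\phi_QH]=\rho_l^{-1}\circ[H]*p_X\circ g*\rho_f\circ\rho_g*Qf$. Moreover, for any choice of homotopies $\xi_QH$, $\phi_QH$ as in 1 and 2, the following hold. 3. Given $f\colon X\to X$, $g\colon X\to Y$, $H_1\colon \mathrm{id}_X\rightsquigarrow f$ and $H_2\colon g*f\rightsquigarrow g$ with $[H_2]\circ g*[H_1]=\mathrm{id}_g$, one has $[\phi_QH_2]\circ Qg*[\xi_QH_1]=\mathrm{id}_{Qg}$. 4. Given $f\colon X\to Y$, $g\colon Y\to Y$, $H_1\colon \mathrm{id}_Y\rightsquigarrow g$ and $H_2\colon g*f\rightsquigarrow f$ with $[H_2]\circ[H_1]*f=\mathrm{id}_f$, one has $[\phi_QH_2]\circ[\xi_QH_1]*Qf=\mathrm{id}_{Qf}$. 5. Given $f\colon X\to Y$, $g\colon Y\to Z$, $h\colon Z\to W$, an arrow $l\colon X\to W$ (in particular $l=h*g*f$ with either bracketing), $H_1\colon g*f\rightsquigarrow g*f$, $H_2\colon h*g\rightsquigarrow h*g$, $H_3\colon h*(g*f)\rightsquigarrow l$ and $H_4\colon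 (h*g)*f\rightsquigarrow l$ with $[H_4]\circ[H_2]*f=[H_3]\circ h*[H_1]$, one has $[\phi_QH_4]\circ[\phi_QH_2]*Qf=[\phi_QH_3]\circ Qh*[\phi_QH_1]$. 6. Given 2-cells $\alpha\colon f_1\Rightarrow f_2$ (between arrows $X\to Y$), $\beta\colon g_1\Rightarrow g_2$ (between arrows $Y\to Z$), $\gamma\colon l_1\Rightarrow l_2$ (between arrows $X\to Z$), $H_1\colon g_1*f_1\rightsquigarrow l_1$ and $H_2\colon g_2*f_2\rightsquigarrow l_2$ with $[H_2]\circ\beta*f_2\circ g_1*\alpha=\gamma\circ[H_1]$, one has $[\phi_QH_2]\circ Q\beta*Qf_2\circ Qg_1*Q\alpha=Q\gamma\circ[\phi_QH_1]$. -/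

import Mathlib

open CategoryTheory Bicategory

universe w v u

namespace ModelBicat

/-! ## Arrows and (bi)limits in a bicategory

Composition is written in diagrammatic order: the composite `g ∗ f` of the usual notation is
`f ≫ g`, the 2-cell `g ∗ α` is `α ▷ g` and the 2-cell `β ∗ f` is `f ◁ β`. -/

section Limits

variable {C : Type u} [Bicategory.{w, v} C]

/-- An arrow is an equivalence if it has a quasiinverse. -/
def IsEquiv {X Y : C} (f : X ⟶ Y) : Prop :=
  ∃ g : Y ⟶ X, Nonempty (f ≫ g ≅ 𝟙 X) ∧ Nonempty (g ≫ f ≅ 𝟙 Y)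

/-- An arrow `f` is a quasiequivalence if all the functors `f_*` (composing with `f` after) and
`f^*` (composing with `f` before) between hom-categories are full and faithful. -/
def IsQuasiequivalence {X Y : C} (f : X ⟶ Y) : Prop :=
  ∀ Z : C, ((postcomp Z f).Full ∧ (postcomp Z f).Faithful) ∧
    ((precomp Z f).Full ∧ (precomp Z f).Faithful)

/-- `I` is a (bi)initial object: each category `C(I, X)` is equivalent to the terminal one. -/
def IsInitialObj (I : C) : Prop :=
  ∀ X : C, Nonempty (I ⟶ X) ∧ ∀ f g : I ⟶ X, Nonempty (Unique (f ⟶ g))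

/-- `T` is a (bi)terminal object: each category `C(X, T)` is equivalent to the terminal one. -/
def IsTerminalObj (T : C) : Prop :=
  ∀ X : C, Nonempty (X ⟶ T) ∧ ∀ f g : X ⟶ T, Nonempty (Unique (f ⟶ g))

/-- `A --i₀--> P <--i₁-- B` is a (bi)coproduct: for each `Z`, the functor
`C(P, Z) ⥤ C(A, Z) × C(B, Z)` is an equivalence (essentially surjective, full and faithful). -/
structure IsCoproduct {A B P : C} (i₀ : A ⟶ P) (i₁ : B ⟶ P) : Prop where
  exists_desc : ∀ {Z : C} (a : A ⟶ Z) (b : B ⟶ Z),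
    ∃ t : P ⟶ Z, Nonempty (i₀ ≫ t ≅ a) ∧ Nonempty (i₁ ≫ t ≅ b)
  existsUnique_cell : ∀ {Z : C} (t t' : P ⟶ Z) (μ₀ : i₀ ≫ t ⟶ i₀ ≫ t') (μ₁ : i₁ ≫ t ⟶ i₁ ≫ t'),
    ∃! δ : t ⟶ t', i₀ ◁ δ = μ₀ ∧ i₁ ◁ δ = μ₁

/-- The square `φ : π₀ ≫ f ≅ π₁ ≫ g` is a (bi)pullback: for each `Z`, the functor from
`C(Z, P)` to the category of squares `a ≫ f ≅ b ≫ g` with vertex `Z` is an equivalence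
(essentially surjective, full and faithful). -/
structure IsPullbackSq {A B D P : C} (f : B ⟶ A) (g : D ⟶ A) (π₀ : P ⟶ B) (π₁ : P ⟶ D)
    (φ : π₀ ≫ f ≅ π₁ ≫ g) : Prop where
  exists_lift : ∀ {Z : C} (a : Z ⟶ B) (b : Z ⟶ D) (γ : a ≫ f ≅ b ≫ g),
    ∃ (t : Z ⟶ P) (l₀ : t ≫ π₀ ≅ a) (l₁ : t ≫ π₁ ≅ b),
      (α_ t π₀ f).inv ≫ l₀.hom ▷ f ≫ γ.hom = t ◁ φ.hom ≫ (α_ t π₁ g).inv ≫ l₁.hom ▷ g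
  existsUnique_cell : ∀ {Z : C} (t t' : Z ⟶ P) (μ₀ : t ≫ π₀ ⟶ t' ≫ π₀) (μ₁ : t ≫ π₁ ⟶ t' ≫ π₁),
    (α_ t π₀ f).inv ≫ μ₀ ▷ f ≫ (α_ t' π₀ f).hom ≫ t' ◁ φ.hom =
      t ◁ φ.hom ≫ (α_ t π₁ g).inv ≫ μ₁ ▷ g ≫ (α_ t' π₁ g).hom →
    ∃! δ : t ⟶ t', δ ▷ π₀ = μ₀ ∧ δ ▷ π₁ = μ₁

/-- The square `φ : f ≫ j₀ ≅ g ≫ j₁` is a (bi)pushout (dual of `IsPullbackSq`). -/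
structure IsPushoutSq {A B D P : C} (f : A ⟶ B) (g : A ⟶ D) (j₀ : B ⟶ P) (j₁ : D ⟶ P)
    (φ : f ≫ j₀ ≅ g ≫ j₁) : Prop where
  exists_desc : ∀ {Z : C} (a : B ⟶ Z) (b : D ⟶ Z) (γ : f ≫ a ≅ g ≫ b),
    ∃ (t : P ⟶ Z) (l₀ : j₀ ≫ t ≅ a) (l₁ : j₁ ≫ t ≅ b),
      (α_ f j₀ t).hom ≫ f ◁ l₀.hom ≫ γ.hom = φ.hom ▷ t ≫ (α_ g j₁ t).hom ≫ g ◁ l₁.hom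
  existsUnique_cell : ∀ {Z : C} (t t' : P ⟶ Z) (μ₀ : j₀ ≫ t ⟶ j₀ ≫ t') (μ₁ : j₁ ≫ t ⟶ j₁ ≫ t'),
    (α_ f j₀ t).hom ≫ f ◁ μ₀ ≫ (α_ f j₀ t').inv ≫ φ.hom ▷ t' =
      φ.hom ▷ t ≫ (α_ g j₁ t).hom ≫ g ◁ μ₁ ≫ (α_ g j₁ t').inv →
    ∃! δ : t ⟶ t', j₀ ◁ δ = μ₀ ∧ j₁ ◁ δ = μ₁

/-- `(f, l, r)` is a filler of the square `γ : a ≫ p ≅ i ≫ b`. -/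
def IsFiller {A X Y B : C} {i : A ⟶ X} {p : Y ⟶ B} {a : A ⟶ Y} {b : X ⟶ B}
    (γ : a ≫ p ≅ i ≫ b) (f : X ⟶ Y) (l : a ≅ i ≫ f) (r : f ≫ p ≅ b) : Prop :=
  l.hom ▷ p ≫ (α_ i f p).hom ≫ i ◁ r.hom = γ.hom

/-- The lifting property of the pair `(i, p)`: existence of fillers, and existence of 2-cells
between given fillers of two squares that are related by 2-cells. -/
structure LiftingProperty {A X Y B : C} (i : A ⟶ X) (p : Y ⟶ B) : Prop where
  exists_filler : ∀ (a : A ⟶ Y) (b : X ⟶ B) (γ : a ≫ p ≅ i ≫ b),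
    ∃ (f : X ⟶ Y) (l : a ≅ i ≫ f) (r : f ≫ p ≅ b), IsFiller γ f l r
  exists_cell : ∀ {a₁ a₂ : A ⟶ Y} {b₁ b₂ : X ⟶ B} (γ₁ : a₁ ≫ p ≅ i ≫ b₁) (γ₂ : a₂ ≫ p ≅ i ≫ b₂)
    (f₁ : X ⟶ Y) (l₁ : a₁ ≅ i ≫ f₁) (r₁ : f₁ ≫ p ≅ b₁)
    (f₂ : X ⟶ Y) (l₂ : a₂ ≅ i ≫ f₂) (r₂ : f₂ ≫ p ≅ b₂),
    IsFiller γ₁ f₁ l₁ r₁ → IsFiller γ₂ f₂ l₂ r₂ →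
    ∀ (α : a₁ ⟶ a₂) (β : b₁ ⟶ b₂), α ▷ p ≫ γ₂.hom = γ₁.hom ≫ i ◁ β →
      ∃ δ : f₁ ⟶ f₂, α ≫ l₂.hom = l₁.hom ≫ i ◁ δ ∧ δ ▷ p ≫ r₂.hom = r₁.hom ≫ β

end Limits

/-! ## Model bicategories -/

/-- A model bicategory structure on `C`: fibrations, cofibrations and weak equivalences
satisfying the following axioms. -/
structure ModelStructure (C : Type u) [Bicategory.{w, v} C] where
  /-- the fibrations -/
  fib : ∀ ⦃X Y : C⦄, (X ⟶ Y) → Prop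
  /-- the cofibrations -/
  cof : ∀ ⦃X Y : C⦄, (X ⟶ Y) → Prop
  /-- the weak equivalences -/
  weq : ∀ ⦃X Y : C⦄, (X ⟶ Y) → Prop
  -- initial and terminal objects, pullbacks and pushouts
  exists_initial : ∃ I : C, IsInitialObj I
  exists_terminal : ∃ T : C, IsTerminalObj T
  exists_pullback : ∀ {A B D : C} (f : B ⟶ A) (g : D ⟶ A),
    ∃ (P : C) (π₀ : P ⟶ B) (π₁ : P ⟶ D) (φ : π₀ ≫ f ≅ π₁ ≫ g), IsPullbackSq f g π₀ π₁ φ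
  exists_pushout : ∀ {A B D : C} (f : A ⟶ B) (g : A ⟶ D),
    ∃ (P : C) (j₀ : B ⟶ P) (j₁ : D ⟶ P) (φ : f ≫ j₀ ≅ g ≫ j₁), IsPushoutSq f g j₀ j₁ φ
  -- lifting
  lifting : ∀ {A X Y B : C} (i : A ⟶ X) (p : Y ⟶ B), cof i → fib p → (weq i ∨ weq p) →
    LiftingProperty i p
  -- factorizations
  exists_fac_trivCof : ∀ {X Y : C} (f : X ⟶ Y), ∃ (Z : C) (i : X ⟶ Z) (p : Z ⟶ Y),
    cof i ∧ weq i ∧ fib p ∧ Nonempty (f ≅ i ≫ p)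
  exists_fac_trivFib : ∀ {X Y : C} (f : X ⟶ Y), ∃ (Z : C) (i : X ⟶ Z) (p : Z ⟶ Y),
    cof i ∧ fib p ∧ weq p ∧ Nonempty (f ≅ i ≫ p)
  -- closure properties of fibrations and cofibrations
  fib_comp : ∀ {X Y Z : C} (f : X ⟶ Y) (g : Y ⟶ Z), fib f → fib g → fib (f ≫ g)
  cof_comp : ∀ {X Y Z : C} (f : X ⟶ Y) (g : Y ⟶ Z), cof f → cof g → cof (f ≫ g)
  fib_pullback : ∀ {A B D P : C} (f : B ⟶ A) (g : D ⟶ A) (π₀ : P ⟶ B) (π₁ : P ⟶ D)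
    (φ : π₀ ≫ f ≅ π₁ ≫ g), IsPullbackSq f g π₀ π₁ φ → fib g → fib π₀
  cof_pushout : ∀ {A B D P : C} (f : A ⟶ B) (g : A ⟶ D) (j₀ : B ⟶ P) (j₁ : D ⟶ P)
    (φ : f ≫ j₀ ≅ g ≫ j₁), IsPushoutSq f g j₀ j₁ φ → cof g → cof j₀
  fib_of_isEquiv : ∀ {X Y : C} (f : X ⟶ Y), IsEquiv f → fib f
  cof_of_isEquiv : ∀ {X Y : C} (f : X ⟶ Y), IsEquiv f → cof f
  fib_of_iso : ∀ {X Y : C} {f g : X ⟶ Y}, (f ≅ g) → fib f → fib g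
  cof_of_iso : ∀ {X Y : C} {f g : X ⟶ Y}, (f ≅ g) → cof f → cof g
  -- stability of trivial fibrations and trivial cofibrations
  weq_pullback : ∀ {A B D P : C} (f : B ⟶ A) (g : D ⟶ A) (π₀ : P ⟶ B) (π₁ : P ⟶ D)
    (φ : π₀ ≫ f ≅ π₁ ≫ g), IsPullbackSq f g π₀ π₁ φ → fib g → weq g → weq π₀
  weq_pushout : ∀ {A B D P : C} (f : A ⟶ B) (g : A ⟶ D) (j₀ : B ⟶ P) (j₁ : D ⟶ P)
    (φ : f ≫ j₀ ≅ g ≫ j₁), IsPushoutSq f g j₀ j₁ φ → cof g → weq g → weq j₀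
  -- three for two
  weq_comp : ∀ {X Y Z : C} (f : X ⟶ Y) (g : Y ⟶ Z) (h : X ⟶ Z), (f ≫ g ≅ h) →
    weq f → weq g → weq h
  weq_of_comp_left : ∀ {X Y Z : C} (f : X ⟶ Y) (g : Y ⟶ Z) (h : X ⟶ Z), (f ≫ g ≅ h) →
    weq f → weq h → weq g
  weq_of_comp_right : ∀ {X Y Z : C} (f : X ⟶ Y) (g : Y ⟶ Z) (h : X ⟶ Z), (f ≫ g ≅ h) →
    weq g → weq h → weq f
  weq_of_isEquiv : ∀ {X Y : C} (f : X ⟶ Y), IsEquiv f → weq f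

section

variable {C : Type u} [Bicategory.{w, v} C] (M : ModelStructure C)

/-- `X` is cofibrant if `0 ⟶ X` is a cofibration. -/
def ModelStructure.IsCofibrant (X : C) : Prop :=
  ∃ (I : C) (_ : IsInitialObj I) (j : I ⟶ X), M.cof j

theorem ModelStructure.weq_id (X : C) : M.weq (𝟙 X) :=
  M.weq_of_isEquiv _ ⟨𝟙 X, ⟨λ_ _⟩, ⟨λ_ _⟩⟩

/-- A cofibrant replacement construction `Q`, as obtained from the factorization and lifting
axioms: a cofibrant object `QX` with a trivial fibration `p_X : QX ⟶ X` for each object `X`, an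
arrow `Qf` with an invertible 2-cell `ρ_f : p_Y ∗ Qf ≅ f ∗ p_X` for each arrow `f`, and a 2-cell
`Qμ` with `p_Y ∗ Qμ = ρ_g⁻¹ ∘ (μ ∗ p_X) ∘ ρ_f` for each 2-cell `μ`. No functoriality is assumed.
The choices may or may not be the trivial ones on cofibrant objects. -/
structure CofibrantReplacement where
  obj : C → C
  p : ∀ X : C, obj X ⟶ X
  cofibrant : ∀ X : C, M.IsCofibrant (obj X)
  fib_p : ∀ X : C, M.fib (p X)
  weq_p : ∀ X : C, M.weq (p X)
  map : ∀ {X Y : C}, (X ⟶ Y) → (obj X ⟶ obj Y)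
  ρ : ∀ {X Y : C} (f : X ⟶ Y), map f ≫ p Y ≅ p X ≫ f
  map₂ : ∀ {X Y : C} {f g : X ⟶ Y}, (f ⟶ g) → (map f ⟶ map g)
  map₂_whiskerRight_p : ∀ {X Y : C} {f g : X ⟶ Y} (μ : f ⟶ g),
    map₂ μ ▷ p Y = (ρ f).hom ≫ p X ◁ μ ≫ (ρ g).inv

end

/-! ## Cylinders and homotopies -/

section Homotopy

variable {C : Type u} [Bicategory.{w, v} C]

/-- A σ-cylinder for `X`, with respect to a family `weq` of weak equivalences. -/
structure SigmaCylinder (weq : ∀ ⦃X Y : C⦄, (X ⟶ Y) → Prop) (X : C) where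
  W : C
  Z : C
  d₀ : X ⟶ W
  d₁ : X ⟶ W
  x : X ⟶ Z
  s : W ⟶ Z
  weq_s : weq s
  α₀ : d₀ ≫ s ≅ x
  α₁ : d₁ ≫ s ≅ x

/-- A left σ-homotopy from `f` to `g`. -/
structure SigmaHomotopy (weq : ∀ ⦃X Y : C⦄, (X ⟶ Y) → Prop) {X Y : C} (f g : X ⟶ Y) where
  cyl : SigmaCylinder weq X
  h : cyl.W ⟶ Y
  eta : f ⟶ cyl.d₀ ≫ h
  eps : cyl.d₁ ≫ h ⟶ g

/-- A w-cylinder for `X`: a σ-cylinder with `Z = X`, `x = id`, such that the arrow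
`X ⨿ X ⟶ W` induced by `d₀` and `d₁` is a cofibration. -/
structure WCylinder (M : ModelStructure C) (X : C) where
  W : C
  d₀ : X ⟶ W
  d₁ : X ⟶ W
  s : W ⟶ X
  weq_s : M.weq s
  α₀ : d₀ ≫ s ≅ 𝟙 X
  α₁ : d₁ ≫ s ≅ 𝟙 X
  cof_d : ∃ (P : C) (i₀ i₁ : X ⟶ P) (_ : IsCoproduct i₀ i₁) (d : P ⟶ W),
    Nonempty (i₀ ≫ d ≅ d₀) ∧ Nonempty (i₁ ≫ d ≅ d₁) ∧ M.cof d

/-- The underlying σ-cylinder of a w-cylinder. -/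
def WCylinder.toSigma {M : ModelStructure C} {X : C} (K : WCylinder M X) :
    SigmaCylinder M.weq X where
  W := K.W
  Z := X
  d₀ := K.d₀
  d₁ := K.d₁
  x := 𝟙 X
  s := K.s
  weq_s := K.weq_s
  α₀ := K.α₀
  α₁ := K.α₁

/-- A left w-homotopy with invertible cells from `f` to `g`: a left σ-homotopy whose cylinder is a
w-cylinder and whose 2-cells `eta` and `eps` are invertible. -/
structure InvWHomotopy (M : ModelStructure C) {X Y : C} (f g : X ⟶ Y) where
  cyl : WCylinder M X
  h : cyl.W ⟶ Y
  eta : f ⟶ cyl.d₀ ≫ h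
  eps : cyl.d₁ ≫ h ⟶ g
  isIso_eta : IsIso eta
  isIso_eps : IsIso eps

/-- The underlying σ-homotopy of a w-homotopy. -/
def InvWHomotopy.toSigma {M : ModelStructure C} {X Y : C} {f g : X ⟶ Y}
    (H : InvWHomotopy M f g) : SigmaHomotopy M.weq f g where
  cyl := H.cyl.toSigma
  h := H.h
  eta := H.eta
  eps := H.eps

variable {weq : ∀ ⦃X Y : C⦄, (X ⟶ Y) → Prop}

/-- The σ-homotopy `r ∗ H`. -/
def SigmaHomotopy.postWhisker {X Y Y' : C} {f g : X ⟶ Y} (H : SigmaHomotopy weq f g)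
    (r : Y ⟶ Y') : SigmaHomotopy weq (f ≫ r) (g ≫ r) where
  cyl := H.cyl
  h := H.h ≫ r
  eta := H.eta ▷ r ≫ (α_ _ _ _).hom
  eps := (α_ _ _ _).inv ≫ H.eps ▷ r

/-- The σ-cylinder obtained by composing the arrows `d₀`, `d₁`, `x` with `l : X' ⟶ X`. -/
def SigmaCylinder.pre {X X' : C} (K : SigmaCylinder weq X) (l : X' ⟶ X) :
    SigmaCylinder weq X' where
  W := K.W
  Z := K.Z
  d₀ := l ≫ K.d₀
  d₁ := l ≫ K.d₁
  x := l ≫ K.x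
  s := K.s
  weq_s := K.weq_s
  α₀ := α_ _ _ _ ≪≫ whiskerLeftIso l K.α₀
  α₁ := α_ _ _ _ ≪≫ whiskerLeftIso l K.α₁

/-- The σ-homotopy `H ∗ l`. -/
def SigmaHomotopy.preWhisker {X X' Y : C} {f g : X ⟶ Y} (l : X' ⟶ X)
    (H : SigmaHomotopy weq f g) : SigmaHomotopy weq (l ≫ f) (l ≫ g) where
  cyl := H.cyl.pre l
  h := H.h
  eta := l ◁ H.eta ≫ (α_ _ _ _).inv
  eps := (α_ _ _ _).hom ≫ l ◁ H.eps

/-- A σ-homotopy `I^μ` representing a 2-cell `μ`. -/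
def ModelStructure.cellHomotopy (M : ModelStructure C) {X Y : C} {f g : X ⟶ Y} (μ : f ⟶ g) :
    SigmaHomotopy M.weq f g where
  cyl :=
    { W := X
      Z := X
      d₀ := 𝟙 X
      d₁ := 𝟙 X
      x := 𝟙 X
      s := 𝟙 X
      weq_s := M.weq_id X
      α₀ := λ_ _
      α₁ := λ_ _ }
  h := f
  eta := (λ_ f).inv
  eps := (λ_ f).hom ≫ μ

section Hat

universe w' v' u'

variable {D : Type u'} [Bicategory.{w', v'} D]

theorem map_associator_inv (F : C ⥤ᵖ D) {X Y Z T : C} (f : X ⟶ Y) (g : Y ⟶ Z) (h : Z ⟶ T) :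
    F.map₂ (α_ f g h).inv = (F.mapComp f (g ≫ h)).hom ≫ F.map f ◁ (F.mapComp g h).hom ≫
      (α_ (F.map f) (F.map g) (F.map h)).inv ≫ (F.mapComp f g).inv ▷ F.map h ≫
        (F.mapComp (f ≫ g) h).inv := by
  rw [F.mapComp_assoc_right_hom_assoc]
  simp [← comp_whiskerRight_assoc]

theorem map_postcomp_aux (F : C ⥤ᵖ D) {X W Y Y' : C} {d₀ d₁ : X ⟶ W} (h : W ⟶ Y) (r : Y ⟶ Y')
    (δ : F.map d₀ ⟶ F.map d₁) :
    F.map₂ (α_ d₀ h r).hom ≫ (F.mapComp d₀ (h ≫ r)).hom ≫ δ ▷ F.map (h ≫ r) ≫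
        (F.mapComp d₁ (h ≫ r)).inv ≫ F.map₂ (α_ d₁ h r).inv =
      (F.mapComp (d₀ ≫ h) r).hom ≫
        ((F.mapComp d₀ h).hom ≫ δ ▷ F.map h ≫ (F.mapComp d₁ h).inv) ▷ F.map r ≫
          (F.mapComp (d₁ ≫ h) r).inv := by
  have e : δ ▷ F.map (h ≫ r) = F.map d₀ ◁ (F.mapComp h r).hom ≫ δ ▷ (F.map h ≫ F.map r) ≫
      F.map d₁ ◁ (F.mapComp h r).inv := by
    rw [whisker_exchange_assoc]; simp [← whiskerLeft_comp]
  rw [e, map_associator_inv F]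
  simp [← whiskerLeft_comp_assoc]

theorem map_precomp_aux (F : C ⥤ᵖ D) {X' X W Y : C} {d₀ d₁ : X ⟶ W} (l : X' ⟶ X) (h : W ⟶ Y)
    (δ : F.map d₀ ⟶ F.map d₁) :
    F.map₂ (α_ l d₀ h).inv ≫ (F.mapComp (l ≫ d₀) h).hom ≫
        ((F.mapComp l d₀).hom ≫ F.map l ◁ δ ≫ (F.mapComp l d₁).inv) ▷ F.map h ≫
          (F.mapComp (l ≫ d₁) h).inv ≫ F.map₂ (α_ l d₁ h).hom =
      (F.mapComp l (d₀ ≫ h)).hom ≫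
        F.map l ◁ ((F.mapComp d₀ h).hom ≫ δ ▷ F.map h ≫ (F.mapComp d₁ h).inv) ≫
          (F.mapComp l (d₁ ≫ h)).inv := by
  rw [map_associator_inv F]
  simp [← comp_whiskerRight_assoc]

theorem map_comp_whiskerLeft_aux (F : C ⥤ᵖ D) {X Y Z T : C} (f : X ⟶ Y) (g : Y ⟶ Z)
    {h h' : Z ⟶ T} (δ : F.map h ⟶ F.map h') :
    (F.mapComp (f ≫ g) h).hom ≫ F.map (f ≫ g) ◁ δ ≫ (F.mapComp (f ≫ g) h').inv =
      F.map₂ (α_ f g h).hom ≫ ((F.mapComp f (g ≫ h)).hom ≫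
        F.map f ◁ ((F.mapComp g h).hom ≫ F.map g ◁ δ ≫ (F.mapComp g h').inv) ≫
          (F.mapComp f (g ≫ h')).inv) ≫ F.map₂ (α_ f g h').inv := by
  have e : F.map (f ≫ g) ◁ δ = (F.mapComp f g).hom ▷ F.map h ≫ (F.map f ≫ F.map g) ◁ δ ≫
      (F.mapComp f g).inv ▷ F.map h' := by
    rw [← whisker_exchange_assoc, hom_inv_whiskerRight, Category.comp_id]
  rw [e, map_associator_inv F, F.map₂_associator]
  simp only [comp_whiskerLeft, whiskerLeft_comp, Category.assoc, Iso.inv_hom_id_assoc,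
    whiskerLeft_inv_hom_assoc]

theorem map_id_whiskerLeft_aux (F : C ⥤ᵖ D) {X Y : C} {f g : X ⟶ Y} (δ : F.map f ⟶ F.map g) :
    (F.mapComp (𝟙 X) f).hom ≫ F.map (𝟙 X) ◁ δ ≫ (F.mapComp (𝟙 X) g).inv =
      F.map₂ (λ_ f).hom ≫ δ ≫ F.map₂ (λ_ g).inv := by
  rw [F.mapComp_id_left_hom, F.mapComp_id_left_inv]
  simp only [Category.assoc]
  rw [← whisker_exchange_assoc, inv_hom_whiskerRight_assoc, leftUnitor_naturality_assoc,
    Iso.inv_hom_id_assoc]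

theorem map_whiskerRight_id_aux (F : C ⥤ᵖ D) {X Y : C} {f g : X ⟶ Y} (δ : F.map f ⟶ F.map g) :
    (F.mapComp f (𝟙 Y)).hom ≫ δ ▷ F.map (𝟙 Y) ≫ (F.mapComp g (𝟙 Y)).inv =
      F.map₂ (ρ_ f).hom ≫ δ ≫ F.map₂ (ρ_ g).inv := by
  rw [F.mapComp_id_right_hom, F.mapComp_id_right_inv]
  simp only [Category.assoc]
  rw [whisker_exchange_assoc, whiskerLeft_inv_hom_assoc, rightUnitor_naturality_assoc,
    Iso.inv_hom_id_assoc]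

/-- `F` maps weak equivalences to quasiequivalences. -/
def Inverts (weq : ∀ ⦃X Y : C⦄, (X ⟶ Y) → Prop) (F : C ⥤ᵖ D) : Prop :=
  ∀ ⦃X Y : C⦄ (s : X ⟶ Y), weq s → IsQuasiequivalence (F.map s)

variable {F : C ⥤ᵖ D} (hF : Inverts weq F) {X X' Y Y' : C}

theorem SigmaCylinder.existsUnique_hat (hF : Inverts weq F) (K : SigmaCylinder weq X) :
    ∃! δ : F.map K.d₀ ⟶ F.map K.d₁, δ ▷ F.map K.s =
      (F.mapComp K.d₀ K.s).inv ≫ F.map₂ (K.α₀.hom ≫ K.α₁.inv) ≫ (F.mapComp K.d₁ K.s).hom := by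
  obtain ⟨⟨h1, h2⟩, -⟩ := hF K.s K.weq_s (F.obj X)
  obtain ⟨δ, hδ⟩ := (postcomp (F.obj X) (F.map K.s)).map_surjective
    ((F.mapComp K.d₀ K.s).inv ≫ F.map₂ (K.α₀.hom ≫ K.α₁.inv) ≫ (F.mapComp K.d₁ K.s).hom)
  exact ⟨δ, hδ, fun δ' hδ' => (postcomp (F.obj X) (F.map K.s)).map_injective (hδ'.trans hδ.symm)⟩

/-- The unique 2-cell `F d₀ ⟶ F d₁` that becomes `F (α₁⁻¹ ∘ α₀)` after composing with `F s`.
(For a 2-functor `F` the cells `F.mapComp` are identities.) -/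
noncomputable def SigmaCylinder.hat (hF : Inverts weq F) (K : SigmaCylinder weq X) :
    F.map K.d₀ ⟶ F.map K.d₁ :=
  (K.existsUnique_hat hF).choose

theorem SigmaCylinder.hat_spec (K : SigmaCylinder weq X) :
    K.hat hF ▷ F.map K.s =
      (F.mapComp K.d₀ K.s).inv ≫ F.map₂ (K.α₀.hom ≫ K.α₁.inv) ≫ (F.mapComp K.d₁ K.s).hom :=
  (K.existsUnique_hat hF).choose_spec.1

theorem SigmaCylinder.eq_hat (K : SigmaCylinder weq X) (δ : F.map K.d₀ ⟶ F.map K.d₁)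
    (hδ : δ ▷ F.map K.s =
      (F.mapComp K.d₀ K.s).inv ≫ F.map₂ (K.α₀.hom ≫ K.α₁.inv) ≫ (F.mapComp K.d₁ K.s).hom) :
    K.hat hF = δ :=
  ((K.existsUnique_hat hF).choose_spec.2 δ hδ).symm

/-- The 2-cell `F f ⟶ F h ∗ F d₀ ⟶ F h ∗ F d₁ ⟶ F g` determined by a σ-homotopy and `F`. -/
noncomputable def SigmaHomotopy.hat (hF : Inverts weq F) {f g : X ⟶ Y}
    (H : SigmaHomotopy weq f g) : F.map f ⟶ F.map g :=
  F.map₂ H.eta ≫ (F.mapComp H.cyl.d₀ H.h).hom ≫ H.cyl.hat hF ▷ F.map H.h ≫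
    (F.mapComp H.cyl.d₁ H.h).inv ≫ F.map₂ H.eps

theorem SigmaHomotopy.hat_postWhisker {f g : X ⟶ Y} (H : SigmaHomotopy weq f g) (r : Y ⟶ Y') :
    (H.postWhisker r).hat hF =
      (F.mapComp f r).hom ≫ H.hat hF ▷ F.map r ≫ (F.mapComp g r).inv := by
  have aux := map_postcomp_aux F H.h r (H.cyl.hat hF)
  have e : (H.postWhisker r).hat hF = F.map₂ (H.eta ▷ r) ≫
      (F.map₂ (α_ H.cyl.d₀ H.h r).hom ≫ (F.mapComp H.cyl.d₀ (H.h ≫ r)).hom ≫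
        H.cyl.hat hF ▷ F.map (H.h ≫ r) ≫ (F.mapComp H.cyl.d₁ (H.h ≫ r)).inv ≫
          F.map₂ (α_ H.cyl.d₁ H.h r).inv) ≫ F.map₂ (H.eps ▷ r) := by
    simp only [Category.assoc, ← F.map₂_comp]
    simp only [← Category.assoc, ← F.map₂_comp]
    simp only [Category.assoc]
    rfl
  rw [e, aux, SigmaHomotopy.hat]
  simp

theorem SigmaCylinder.hat_pre (K : SigmaCylinder weq X) (l : X' ⟶ X) :
    (K.pre l).hat hF =
      (F.mapComp l K.d₀).hom ≫ F.map l ◁ K.hat hF ≫ (F.mapComp l K.d₁).inv := by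
  apply SigmaCylinder.eq_hat
  have aux := map_precomp_aux F l K.s (K.hat hF)
  rw [K.hat_spec hF] at aux
  have e : (F.mapComp K.d₀ K.s).hom ≫ ((F.mapComp K.d₀ K.s).inv ≫
      F.map₂ (K.α₀.hom ≫ K.α₁.inv) ≫ (F.mapComp K.d₁ K.s).hom) ≫ (F.mapComp K.d₁ K.s).inv =
        F.map₂ (K.α₀.hom ≫ K.α₁.inv) := by simp
  rw [e, ← F.map₂_whisker_left] at aux
  change ((F.mapComp l K.d₀).hom ≫ F.map l ◁ K.hat hF ≫ (F.mapComp l K.d₁).inv) ▷ F.map K.s =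
    (F.mapComp (l ≫ K.d₀) K.s).inv ≫ F.map₂ (((α_ l K.d₀ K.s).hom ≫ l ◁ K.α₀.hom) ≫
      (l ◁ K.α₁.inv ≫ (α_ l K.d₁ K.s).inv)) ≫ (F.mapComp (l ≫ K.d₁) K.s).hom
  rw [← cancel_mono (F.mapComp (l ≫ K.d₁) K.s).inv, ← cancel_epi (F.mapComp (l ≫ K.d₀) K.s).hom,
    ← cancel_mono (F.map₂ (α_ l K.d₁ K.s).hom), ← cancel_epi (F.map₂ (α_ l K.d₀ K.s).inv)]
  simp only [Category.assoc] at aux ⊢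
  refine aux.trans ?_
  simp only [Iso.hom_inv_id_assoc, ← F.map₂_comp]
  simp only [Category.assoc, Iso.inv_hom_id_assoc, Category.comp_id, Iso.inv_hom_id,
    whiskerLeft_comp]

theorem SigmaHomotopy.hat_preWhisker {f g : X ⟶ Y} (l : X' ⟶ X) (H : SigmaHomotopy weq f g) :
    (H.preWhisker l).hat hF =
      (F.mapComp l f).hom ≫ F.map l ◁ H.hat hF ≫ (F.mapComp l g).inv := by
  have aux := map_precomp_aux F l H.h (H.cyl.hat hF)
  have e : (H.preWhisker l).hat hF = F.map₂ (l ◁ H.eta ≫ (α_ l H.cyl.d₀ H.h).inv) ≫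
      (F.mapComp (l ≫ H.cyl.d₀) H.h).hom ≫ (show F.map (l ≫ H.cyl.d₀) ⟶ F.map (l ≫ H.cyl.d₁) from
        (H.cyl.pre l).hat hF) ▷ F.map H.h ≫ (F.mapComp (l ≫ H.cyl.d₁) H.h).inv ≫
          F.map₂ ((α_ l H.cyl.d₁ H.h).hom ≫ l ◁ H.eps) := rfl
  have k : (show F.map (l ≫ H.cyl.d₀) ⟶ F.map (l ≫ H.cyl.d₁) from (H.cyl.pre l).hat hF) = _ :=
    H.cyl.hat_pre hF l
  rw [e, k, F.map₂_comp, F.map₂_comp]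
  have aux' := congrArg (fun t => F.map₂ (l ◁ H.eta) ≫ t ≫ F.map₂ (l ◁ H.eps)) aux
  simp only [Category.assoc] at aux' ⊢
  rw [aux', SigmaHomotopy.hat]
  simp

theorem ModelStructure.hat_cellHomotopy {M : ModelStructure C} (hF : Inverts M.weq F)
    {f g : X ⟶ Y} (μ : f ⟶ g) :
    (M.cellHomotopy μ).hat hF = F.map₂ μ := by
  have key : (show F.map (𝟙 X) ⟶ F.map (𝟙 X) from ((M.cellHomotopy μ).cyl).hat hF) =
      𝟙 (F.map (𝟙 X)) := by
    apply SigmaCylinder.eq_hat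
    change 𝟙 (F.map (𝟙 X)) ▷ F.map (𝟙 X) = (F.mapComp (𝟙 X) (𝟙 X)).inv ≫
      F.map₂ ((λ_ (𝟙 X)).hom ≫ (λ_ (𝟙 X)).inv) ≫ (F.mapComp (𝟙 X) (𝟙 X)).hom
    rw [Iso.hom_inv_id, F.map₂_id, id_whiskerRight, Category.id_comp, Iso.inv_hom_id]
  have e : (M.cellHomotopy μ).hat hF = F.map₂ (λ_ f).inv ≫ (F.mapComp (𝟙 X) f).hom ≫
      (show F.map (𝟙 X) ⟶ F.map (𝟙 X) from ((M.cellHomotopy μ).cyl).hat hF) ▷ F.map f ≫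
        (F.mapComp (𝟙 X) f).inv ≫ F.map₂ ((λ_ f).hom ≫ μ) := rfl
  rw [e, key, id_whiskerRight, Category.id_comp, Iso.hom_inv_id_assoc, ← F.map₂_comp,
    Iso.inv_hom_id_assoc]

end Hat
end Homotopy

/-! ## The bicategory `Ho(C, W)`

Its objects and arrows are those of `C`, its 2-cells are the classes of finite composable sequences
of σ-homotopies, two sequences being in the same class if they have the same image under all
2-functors that map weak equivalences to quasiequivalences. -/

section Ho

variable {C : Type u} [Bicategory.{w, v} C]

/-- Finite composable sequences of σ-homotopies from `f` to `g`. -/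
inductive HomotopySeq (weq : ∀ ⦃X Y : C⦄, (X ⟶ Y) → Prop) {X Y : C} :
    (X ⟶ Y) → (X ⟶ Y) → Type (max u v w) where
  | nil (f : X ⟶ Y) : HomotopySeq weq f f
  | cons {f g k : X ⟶ Y} (H : SigmaHomotopy weq f g) (t : HomotopySeq weq g k) :
      HomotopySeq weq f k

namespace HomotopySeq

variable {weq : ∀ ⦃X Y : C⦄, (X ⟶ Y) → Prop}

/-- Juxtaposition of sequences. -/
def append {X Y : C} {f g k : X ⟶ Y} :
    HomotopySeq weq f g → HomotopySeq weq g k → HomotopySeq weq f k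
  | nil _, t => t
  | cons H t', t => cons H (append t' t)

/-- Composition of each homotopy of the sequence with `r`. -/
def postWhisker {X Y Y' : C} (r : Y ⟶ Y') {f g : X ⟶ Y} :
    HomotopySeq weq f g → HomotopySeq weq (f ≫ r) (g ≫ r)
  | nil f => nil (f ≫ r)
  | cons H t => cons (H.postWhisker r) (postWhisker r t)

/-- Composition of each homotopy of the sequence with `l`. -/
def preWhisker {X X' Y : C} (l : X' ⟶ X) {f g : X ⟶ Y} :
    HomotopySeq weq f g → HomotopySeq weq (l ≫ f) (l ≫ g)
  | nil f => nil (l ≫ f)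
  | cons H t => cons (H.preWhisker l) (preWhisker l t)

universe w' v' u'

variable {D : Type u'} [Bicategory.{w', v'} D] {F : C ⥤ᵖ D}

/-- The 2-cell determined by a sequence of σ-homotopies and `F`. -/
noncomputable def hat (hF : Inverts weq F) {X Y : C} {f g : X ⟶ Y} :
    HomotopySeq weq f g → (F.map f ⟶ F.map g)
  | nil f => 𝟙 (F.map f)
  | cons H t => H.hat hF ≫ hat hF t

theorem hat_append (hF : Inverts weq F) {X Y : C} {f g k : X ⟶ Y}
    (s : HomotopySeq weq f g) (t : HomotopySeq weq g k) :
    (s.append t).hat hF = s.hat hF ≫ t.hat hF := by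
  induction s with
  | nil f => simp [append, hat]
  | cons H s ih => simp [append, hat, ih]

theorem hat_postWhisker (hF : Inverts weq F) {X Y Y' : C} (r : Y ⟶ Y') {f g : X ⟶ Y}
    (s : HomotopySeq weq f g) :
    (s.postWhisker r).hat hF =
      (F.mapComp f r).hom ≫ s.hat hF ▷ F.map r ≫ (F.mapComp g r).inv := by
  induction s with
  | nil f => simp [postWhisker, hat]
  | cons H s ih => simp [postWhisker, hat, ih, H.hat_postWhisker hF]

theorem hat_preWhisker (hF : Inverts weq F) {X X' Y : C} (l : X' ⟶ X) {f g : X ⟶ Y}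
    (s : HomotopySeq weq f g) :
    (s.preWhisker l).hat hF =
      (F.mapComp l f).hom ≫ F.map l ◁ s.hat hF ≫ (F.mapComp l g).inv := by
  induction s with
  | nil f => simp [preWhisker, hat]
  | cons H s ih => simp [preWhisker, hat, ih, H.hat_preWhisker hF]

end HomotopySeq

variable (M : ModelStructure C)

/-- Two sequences are in the same class if they determine the same 2-cell for each 2-functor `F`
from `C` to a bicategory `D` that maps the weak equivalences to quasiequivalences.

The universe levels of `D` are those of `Ho(C, W)` itself. This is no restriction: a 2-functor into
a larger bicategory factors through the bicategory with the objects and arrows of `C` whose 2-cells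
are generated, under compositions and unique liftings along weak equivalences, by those of `C`. -/
def SameClass {X Y : C} {f g : X ⟶ Y} (s t : HomotopySeq M.weq f g) : Prop :=
  ∀ (D : Type u) [Bicategory.{max u v w, v} D] (F : StrictPseudofunctor C D)
    (hF : Inverts M.weq F.toPseudofunctor), s.hat hF = t.hat hF

/-- The equivalence relation between sequences of σ-homotopies. -/
def homotopySetoid {X Y : C} (f g : X ⟶ Y) : Setoid (HomotopySeq M.weq f g) where
  r := SameClass M
  iseqv :=
    { refl := fun _ _ _ _ _ => rfl
      symm := fun h D _ F hF => (h D F hF).symm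
      trans := fun h h' D _ F hF => (h D F hF).trans (h' D F hF) }

/-- The objects of `Ho(C, W)`. -/
@[ext]
structure Ho (M : ModelStructure C) : Type u where
  as : C

namespace Ho

variable {M}

/-- The arrows of `Ho(C, W)`. -/
@[ext]
structure Hom (A B : Ho M) : Type v where
  as : A.as ⟶ B.as

instance : CategoryStruct (Ho M) where
  Hom A B := Hom A B
  id A := ⟨𝟙 A.as⟩
  comp f g := ⟨f.as ≫ g.as⟩

/-- The 2-cells of `Ho(C, W)`. -/
def Cell {A B : Ho M} (f g : A ⟶ B) : Type (max u v w) :=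
  Quotient (homotopySetoid M f.as g.as)

/-- The image of a 2-cell of `Ho(C, W)` under the extension of a 2-functor `F`. -/
noncomputable def Cell.hat {A B : Ho M} {f g : A ⟶ B} (c : Cell f g) {D : Type u}
    [Bicategory.{max u v w, v} D] (F : StrictPseudofunctor C D)
    (hF : Inverts M.weq F.toPseudofunctor) : F.map f.as ⟶ F.map g.as :=
  Quotient.lift (fun s : HomotopySeq M.weq f.as g.as => s.hat hF)
    (fun s t (h : SameClass M s t) => h D F hF) c

theorem Cell.ext_hat {A B : Ho M} {f g : A ⟶ B} {c c' : Cell f g}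
    (h : ∀ (D : Type u) [Bicategory.{max u v w, v} D] (F : StrictPseudofunctor C D)
      (hF : Inverts M.weq F.toPseudofunctor), c.hat F hF = c'.hat F hF) : c = c' := by
  induction c using Quotient.ind
  induction c' using Quotient.ind
  exact Quotient.sound h

/-- Vertical composition, by juxtaposition. -/
def Cell.comp {A B : Ho M} {f g k : A ⟶ B} (c : Cell f g) (c' : Cell g k) : Cell f k :=
  Quotient.map₂ HomotopySeq.append (by
    intro s s' h t t' h' D _ F hF
    have e₁ : s.hat hF = s'.hat hF := h D F hF
    have e₂ : t.hat hF = t'.hat hF := h' D F hF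
    rw [HomotopySeq.hat_append, HomotopySeq.hat_append, e₁, e₂]) c c'

/-- The composition `r ∗ c`. -/
def Cell.postWhisker {A B B' : Ho M} {f g : A ⟶ B} (c : Cell f g) (r : B ⟶ B') :
    Cell (f ≫ r) (g ≫ r) :=
  Quotient.map (HomotopySeq.postWhisker r.as) (by
    intro s s' h D _ F hF
    have e : s.hat hF = s'.hat hF := h D F hF
    rw [HomotopySeq.hat_postWhisker, HomotopySeq.hat_postWhisker, e]) c

/-- The composition `c ∗ l`. -/
def Cell.preWhisker {A' A B : Ho M} (l : A' ⟶ A) {f g : A ⟶ B} (c : Cell f g) :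
    Cell (l ≫ f) (l ≫ g) :=
  Quotient.map (HomotopySeq.preWhisker l.as) (by
    intro s s' h D _ F hF
    have e : s.hat hF = s'.hat hF := h D F hF
    rw [HomotopySeq.hat_preWhisker, HomotopySeq.hat_preWhisker, e]) c

/-- The class of a 2-cell `μ` of `C`, i.e. the class of the sequence `I^μ`. -/
def Cell.of {A B : Ho M} {f g : A ⟶ B} (μ : f.as ⟶ g.as) : Cell f g :=
  Quotient.mk _ (.cons (M.cellHomotopy μ) (.nil _))

section

variable {A A' B B' : Ho M} {f g k : A ⟶ B} {D : Type u} [Bicategory.{max u v w, v} D]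
  (F : StrictPseudofunctor C D) (hF : Inverts M.weq F.toPseudofunctor)

theorem Cell.hat_comp (c : Cell f g) (c' : Cell g k) :
    (c.comp c').hat F hF = c.hat F hF ≫ c'.hat F hF := by
  induction c using Quotient.ind
  induction c' using Quotient.ind
  exact HomotopySeq.hat_append _ _ _

theorem Cell.hat_postWhisker (c : Cell f g) (r : B ⟶ B') :
    (c.postWhisker r).hat F hF =
      (F.mapComp f.as r.as).hom ≫ c.hat F hF ▷ F.map r.as ≫ (F.mapComp g.as r.as).inv := by
  induction c using Quotient.ind
  exact HomotopySeq.hat_postWhisker _ _ _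

theorem Cell.hat_preWhisker (l : A' ⟶ A) (c : Cell f g) :
    (c.preWhisker l).hat F hF =
      (F.mapComp l.as f.as).hom ≫ F.map l.as ◁ c.hat F hF ≫ (F.mapComp l.as g.as).inv := by
  induction c using Quotient.ind
  exact HomotopySeq.hat_preWhisker _ _ _

theorem Cell.hat_of (μ : f.as ⟶ g.as) :
    (Cell.of μ : Cell f g).hat F hF = F.map₂ μ := by
  change (M.cellHomotopy μ).hat hF ≫ 𝟙 _ = _
  rw [Category.comp_id, ModelStructure.hat_cellHomotopy]

theorem Cell.hat_of_id (f : A ⟶ B) :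
    (Cell.of (𝟙 f.as) : Cell f f).hat F hF = 𝟙 _ := by
  rw [Cell.hat_of, F.map₂_id]

end

instance (A B : Ho M) : Category (A ⟶ B) where
  Hom f g := Cell f g
  id f := Cell.of (𝟙 f.as)
  comp c c' := c.comp c'
  id_comp c := Cell.ext_hat fun D _ F hF => by
    rw [Cell.hat_comp, Cell.hat_of_id, Category.id_comp]
  comp_id c := Cell.ext_hat fun D _ F hF => by
    rw [Cell.hat_comp, Cell.hat_of_id, Category.comp_id]
  assoc c c' c'' := Cell.ext_hat fun D _ F hF => by
    simp only [Cell.hat_comp, Category.assoc]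

/-- The invertible 2-cell of `Ho(C, W)` given by an invertible 2-cell of `C`. -/
def isoOf {A B : Ho M} {f g : A ⟶ B} (e : f.as ≅ g.as) : f ≅ g where
  hom := (Cell.of e.hom : Cell f g)
  inv := (Cell.of e.inv : Cell g f)
  hom_inv_id := Cell.ext_hat fun D _ F hF => by
    refine (Cell.hat_comp F hF _ _).trans ?_
    rw [Cell.hat_of, Cell.hat_of, ← F.map₂_comp, e.hom_inv_id]
    exact (Cell.hat_of F hF _).symm
  inv_hom_id := Cell.ext_hat fun D _ F hF => by
    refine (Cell.hat_comp F hF _ _).trans ?_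
    rw [Cell.hat_of, Cell.hat_of, ← F.map₂_comp, e.inv_hom_id]
    exact (Cell.hat_of F hF _).symm

/-! The axioms of a bicategory. -/

section

variable {A B A₁ A₂ A₃ : Ho M}

theorem whisker_id_left (l : A ⟶ B) (f : B ⟶ A₁) :
    Cell.preWhisker l (Cell.of (𝟙 f.as)) = (Cell.of (𝟙 (l ≫ f).as) : Cell (l ≫ f) (l ≫ f)) :=
  Cell.ext_hat fun D _ F hF => by
    rw [Cell.hat_preWhisker, Cell.hat_of_id, Cell.hat_of_id, whiskerLeft_id, Category.id_comp,
      Iso.hom_inv_id]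
    rfl

theorem whisker_id_right (f : A ⟶ B) (r : B ⟶ A₁) :
    Cell.postWhisker (Cell.of (𝟙 f.as)) r = (Cell.of (𝟙 (f ≫ r).as) : Cell (f ≫ r) (f ≫ r)) :=
  Cell.ext_hat fun D _ F hF => by
    rw [Cell.hat_postWhisker, Cell.hat_of_id, Cell.hat_of_id, id_whiskerRight, Category.id_comp,
      Iso.hom_inv_id]
    rfl

theorem whisker_comp_left (l : A ⟶ B) {f g k : B ⟶ A₁} (c : Cell f g) (c' : Cell g k) :
    Cell.preWhisker l (c.comp c') = (Cell.preWhisker l c).comp (Cell.preWhisker l c') :=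
  Cell.ext_hat fun D _ F hF => by
    simp only [Cell.hat_preWhisker, Cell.hat_comp, whiskerLeft_comp, Category.assoc,
      Iso.inv_hom_id_assoc]

theorem whisker_comp_right {f g k : A ⟶ B} (c : Cell f g) (c' : Cell g k) (r : B ⟶ A₁) :
    Cell.postWhisker (c.comp c') r = (c.postWhisker r).comp (c'.postWhisker r) :=
  Cell.ext_hat fun D _ F hF => by
    simp only [Cell.hat_postWhisker, Cell.hat_comp, comp_whiskerRight, Category.assoc,
      Iso.inv_hom_id_assoc]

theorem whisker_left_unit {f g : A ⟶ B} (c : Cell f g) :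
    Cell.preWhisker (𝟙 A) c = (Cell.of (λ_ f.as).hom : Cell (𝟙 A ≫ f) f).comp
      (c.comp (Cell.of (λ_ g.as).inv : Cell g (𝟙 A ≫ g))) :=
  Cell.ext_hat fun D _ F hF => by
    simp only [Cell.hat_preWhisker, Cell.hat_comp, Cell.hat_of]
    exact map_id_whiskerLeft_aux F.toPseudofunctor (c.hat F hF)

theorem whisker_right_unit {f g : A ⟶ B} (c : Cell f g) :
    Cell.postWhisker c (𝟙 B) = (Cell.of (ρ_ f.as).hom : Cell (f ≫ 𝟙 B) f).comp
      (c.comp (Cell.of (ρ_ g.as).inv : Cell g (g ≫ 𝟙 B))) :=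
  Cell.ext_hat fun D _ F hF => by
    simp only [Cell.hat_postWhisker, Cell.hat_comp, Cell.hat_of]
    exact map_whiskerRight_id_aux F.toPseudofunctor (c.hat F hF)

theorem whisker_left_left (f : A ⟶ B) (g : B ⟶ A₁) {h h' : A₁ ⟶ A₂} (c : Cell h h') :
    Cell.preWhisker (f ≫ g) c =
      (Cell.of (α_ f.as g.as h.as).hom : Cell ((f ≫ g) ≫ h) (f ≫ g ≫ h)).comp
        ((Cell.preWhisker f (Cell.preWhisker g c)).comp
          (Cell.of (α_ f.as g.as h'.as).inv : Cell (f ≫ g ≫ h') ((f ≫ g) ≫ h'))) :=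
  Cell.ext_hat fun D _ F hF => by
    simp only [Cell.hat_preWhisker, Cell.hat_comp, Cell.hat_of]
    exact map_comp_whiskerLeft_aux F.toPseudofunctor f.as g.as (c.hat F hF)

theorem whisker_right_right {f f' : A ⟶ B} (c : Cell f f') (g : B ⟶ A₁) (h : A₁ ⟶ A₂) :
    Cell.postWhisker c (g ≫ h) =
      (Cell.of (α_ f.as g.as h.as).inv : Cell (f ≫ g ≫ h) ((f ≫ g) ≫ h)).comp
        (((c.postWhisker g).postWhisker h).comp
          (Cell.of (α_ f'.as g.as h.as).hom : Cell ((f' ≫ g) ≫ h) (f' ≫ g ≫ h))) :=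
  Cell.ext_hat fun D _ F hF => by
    simp only [Cell.hat_postWhisker, Cell.hat_comp, Cell.hat_of]
    have aux := map_postcomp_aux F.toPseudofunctor g.as h.as (c.hat F hF)
    refine Eq.trans ?_ (congrArg (fun t => F.map₂ (α_ f.as g.as h.as).inv ≫ t ≫
      F.map₂ (α_ f'.as g.as h.as).hom) aux)
    simp only [Category.assoc, ← F.map₂_comp, ← F.map₂_comp_assoc, Iso.inv_hom_id, F.map₂_id,
      Category.id_comp, Category.comp_id]
    rfl

theorem whisker_left_right (f : A ⟶ B) {g g' : B ⟶ A₁} (c : Cell g g') (h : A₁ ⟶ A₂) :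
    (Cell.preWhisker f c).postWhisker h =
      (Cell.of (α_ f.as g.as h.as).hom : Cell ((f ≫ g) ≫ h) (f ≫ g ≫ h)).comp
        ((Cell.preWhisker f (c.postWhisker h)).comp
          (Cell.of (α_ f.as g'.as h.as).inv : Cell (f ≫ g' ≫ h) ((f ≫ g') ≫ h))) :=
  Cell.ext_hat fun D _ F hF => by
    simp only [Cell.hat_preWhisker, Cell.hat_postWhisker, Cell.hat_comp, Cell.hat_of]
    have aux := map_precomp_aux F.toPseudofunctor f.as h.as (c.hat F hF)
    refine Eq.trans ?_ (congrArg (fun t => F.map₂ (α_ f.as g.as h.as).hom ≫ t ≫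
      F.map₂ (α_ f.as g'.as h.as).inv) aux)
    simp only [Category.assoc, ← F.map₂_comp, ← F.map₂_comp_assoc, Iso.hom_inv_id, F.map₂_id,
      Category.id_comp, Category.comp_id]
    rfl

theorem whisker_exch {f g : A ⟶ B} {h i : B ⟶ A₁} (c : Cell f g) (c' : Cell h i) :
    (Cell.preWhisker f c').comp (c.postWhisker i) =
      (c.postWhisker h).comp (Cell.preWhisker g c') :=
  Cell.ext_hat fun D _ F hF => by
    simp only [Cell.hat_preWhisker, Cell.hat_postWhisker, Cell.hat_comp, Category.assoc,
      Iso.inv_hom_id_assoc, whisker_exchange_assoc]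

theorem of_comp {f g k : A ⟶ B} (μ : f.as ⟶ g.as) (ν : g.as ⟶ k.as) :
    (Cell.of μ : Cell f g).comp (Cell.of ν : Cell g k) = Cell.of (μ ≫ ν) :=
  Cell.ext_hat fun D _ F hF => by
    rw [Cell.hat_comp, Cell.hat_of, Cell.hat_of, Cell.hat_of, F.map₂_comp]

theorem of_whiskerRight {f g : A ⟶ B} (μ : f.as ⟶ g.as) (r : B ⟶ A₁) :
    (Cell.of μ : Cell f g).postWhisker r = (Cell.of (μ ▷ r.as) : Cell (f ≫ r) (g ≫ r)) :=
  Cell.ext_hat fun D _ F hF => by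
    rw [Cell.hat_postWhisker, Cell.hat_of, Cell.hat_of, F.map₂_whisker_right]

theorem of_whiskerLeft (l : A₁ ⟶ A) {f g : A ⟶ B} (μ : f.as ⟶ g.as) :
    Cell.preWhisker l (Cell.of μ : Cell f g) = (Cell.of (l.as ◁ μ) : Cell (l ≫ f) (l ≫ g)) :=
  Cell.ext_hat fun D _ F hF => by
    rw [Cell.hat_preWhisker, Cell.hat_of, Cell.hat_of, F.map₂_whisker_left]

end

/-- The bicategory `Ho(C, W)`. -/
instance : Bicategory (Ho M) where
  whiskerLeft l _ _ c := Cell.preWhisker l c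
  whiskerRight c r := Cell.postWhisker c r
  associator f g h := isoOf (f := (f ≫ g) ≫ h) (g := f ≫ g ≫ h) (α_ f.as g.as h.as)
  leftUnitor f := isoOf (f := 𝟙 _ ≫ f) (g := f) (λ_ f.as)
  rightUnitor f := isoOf (f := f ≫ 𝟙 _) (g := f) (ρ_ f.as)
  whiskerLeft_id f g := whisker_id_left f g
  whiskerLeft_comp f _ _ _ c c' := whisker_comp_left f c c'
  id_whiskerLeft c := whisker_left_unit c
  comp_whiskerLeft f g _ _ c := whisker_left_left f g c
  id_whiskerRight f g := whisker_id_right f g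
  comp_whiskerRight c c' g := whisker_comp_right c c' g
  whiskerRight_id c := whisker_right_unit c
  whiskerRight_comp c g h := whisker_right_right c g h
  whisker_assoc f _ _ c h := whisker_left_right f c h
  whisker_exchange c c' := whisker_exch c c'
  pentagon f g h i := by
    change ((Cell.of _ : Cell _ _).postWhisker i).comp
      ((Cell.of _ : Cell _ _).comp (Cell.preWhisker f (Cell.of _ : Cell _ _))) =
        (Cell.of _ : Cell _ _).comp (Cell.of _ : Cell _ _)
    rw [of_whiskerRight, of_whiskerLeft, of_comp, of_comp, of_comp]
    exact congrArg Cell.of (pentagon f.as g.as h.as i.as)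
  triangle f g := by
    change (Cell.of _ : Cell _ _).comp (Cell.preWhisker f (Cell.of _ : Cell _ _)) =
      (Cell.of _ : Cell _ _).postWhisker g
    rw [of_whiskerRight, of_whiskerLeft, of_comp]
    exact congrArg Cell.of (triangle f.as g.as)

/-- An arrow of `C`, seen as an arrow of `Ho(C, W)`. -/
abbrev arr (M : ModelStructure C) {X Y : C} (f : X ⟶ Y) : (Ho.mk X : Ho M) ⟶ Ho.mk Y := ⟨f⟩

/-- A 2-cell of `C`, seen as a 2-cell of `Ho(C, W)`. -/
def cell (M : ModelStructure C) {X Y : C} {f g : X ⟶ Y} (μ : f ⟶ g) : arr M f ⟶ arr M g :=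
  (Cell.of μ : Cell (arr M f) (arr M g))

end Ho

/-- The class in `Ho(C, W)` of a σ-homotopy. -/
def SigmaHomotopy.cls {M : ModelStructure C} {X Y : C} {f g : X ⟶ Y}
    (H : SigmaHomotopy M.weq f g) : Ho.arr M f ⟶ Ho.arr M g :=
  (Quotient.mk _ (.cons H (.nil g)) : Ho.Cell (Ho.arr M f) (Ho.arr M g))

/-- The class in `Ho(C, W)` of a left w-homotopy with invertible cells. -/
def InvWHomotopy.cls {M : ModelStructure C} {X Y : C} {f g : X ⟶ Y}
    (H : InvWHomotopy M f g) : Ho.arr M f ⟶ Ho.arr M g :=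
  H.toSigma.cls

namespace CofibrantReplacement

variable {M} (Q : CofibrantReplacement M)

/-- For `H : id_X ⇝ f`, the condition `p_X ∗ [K] = ρ_f⁻¹ ∘ [H] ∗ p_X` on a left w-homotopy with
invertible cells `K : id_{QX} ⇝ Qf`, i.e. `K` is an admissible choice of `ξ_Q H`. -/
def IsXi {X : C} {f : X ⟶ X} (H : InvWHomotopy M (𝟙 X) f)
    (K : InvWHomotopy M (𝟙 (Q.obj X)) (Q.map f)) : Prop :=
  K.cls ▷ Ho.arr M (Q.p X) =
    (λ_ (Ho.arr M (Q.p X))).hom ≫ (ρ_ (Ho.arr M (Q.p X))).inv ≫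
      Ho.arr M (Q.p X) ◁ H.cls ≫ Ho.cell M (Q.ρ f).inv

/-- For `H : g ∗ f ⇝ l`, the condition
`p_Z ∗ [K] = ρ_l⁻¹ ∘ [H] ∗ p_X ∘ g ∗ ρ_f ∘ ρ_g ∗ Qf` on a left w-homotopy with invertible cells
`K : Qg ∗ Qf ⇝ Ql`, i.e. `K` is an admissible choice of `φ_Q H`. -/
def IsPhi {X Y Z : C} {f : X ⟶ Y} {g : Y ⟶ Z} {l : X ⟶ Z} (H : InvWHomotopy M (f ≫ g) l)
    (K : InvWHomotopy M (Q.map f ≫ Q.map g) (Q.map l)) : Prop :=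
  K.cls ▷ Ho.arr M (Q.p Z) =
    (α_ (Ho.arr M (Q.map f)) (Ho.arr M (Q.map g)) (Ho.arr M (Q.p Z))).hom ≫
      Ho.arr M (Q.map f) ◁ Ho.cell M (Q.ρ g).hom ≫
      (α_ (Ho.arr M (Q.map f)) (Ho.arr M (Q.p Y)) (Ho.arr M g)).inv ≫
      Ho.cell M (Q.ρ f).hom ▷ Ho.arr M g ≫
      (α_ (Ho.arr M (Q.p X)) (Ho.arr M f) (Ho.arr M g)).hom ≫
      Ho.arr M (Q.p X) ◁ H.cls ≫ Ho.cell M (Q.ρ l).inv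

end CofibrantReplacement

end Ho
end ModelBicat

open ModelBicat

/-! Everything rests on two facts about a trivial fibration `p`. Uniqueness: every 2-functor that
tests equality in `Ho M` sends `p` to a quasiequivalence, so `c ↦ c ▷ p` is injective on 2-cells of
`Ho M` (`Ho.whiskerRight_injective_of_weq`). The unit, associativity and naturality equations may
therefore be checked after composing with the projection of the replacement. There the classes of
the chosen homotopies are known by `IsXi` and `IsPhi`, and only a pasting computation with
interchange remains, valid in any bicategory. Existence: a homotopy `H : f ⇝ g` on `X` lifts along
trivial fibrations `q : A ⟶ X` and `p : Y' ⟶ Y` to a homotopy between any `u`, `v` lying over `q ≫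
f`, `q ≫ g` (`InvWHomotopy.exists_lift`). Factor the arrow `A ⨿ A ⟶ W` into the cylinder of `H` as a
cofibration into some `V` followed by a trivial fibration `m`. Lifting against `q` makes `V` a
cylinder of `A`; lifting against `p` gives the homotopy on it. To compare the classes, each is
expressed by the universal homotopy `d₀ ⇝ d₁` of its cylinder, and the two universal homotopies are
compared after composing with the weak equivalence `s : W ⟶ X`, where both become 2-cells of `C`. -/

namespace ModelBicat

/-! ### Binary coproducts in a model bicategory. -/

section Coproduct

variable {C : Type u} [Bicategory.{w, v} C]

/-- A coproduct is a pushout over an initial object. -/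
theorem IsPushoutSq.isCoproduct {I A B P : C} (hI : IsInitialObj I) {f : I ⟶ A} {g : I ⟶ B}
    {j₀ : A ⟶ P} {j₁ : B ⟶ P} {φ : f ≫ j₀ ≅ g ≫ j₁} (h : IsPushoutSq f g j₀ j₁ φ) :
    IsCoproduct j₀ j₁ where
  exists_desc {Z} a b := by
    -- Parallel arrows out of an initial object are joined by exactly one 2-cell; this supplies the
    -- invertible 2-cell that the pushout asks for, together with its inverse laws.
    obtain ⟨u₁⟩ := (hI Z).2 (f ≫ a) (g ≫ b)
    obtain ⟨u₂⟩ := (hI Z).2 (g ≫ b) (f ≫ a)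
    obtain ⟨u₃⟩ := (hI Z).2 (f ≫ a) (f ≫ a)
    obtain ⟨u₄⟩ := (hI Z).2 (g ≫ b) (g ≫ b)
    obtain ⟨t, l₀, l₁, -⟩ := h.exists_desc a b
      ⟨u₁.default, u₂.default, (u₃.uniq _).trans (u₃.uniq _).symm,
        (u₄.uniq _).trans (u₄.uniq _).symm⟩
    exact ⟨t, ⟨l₀⟩, ⟨l₁⟩⟩
  existsUnique_cell {Z} t t' μ₀ μ₁ := by
    -- The compatibility condition equates two parallel 2-cells out of `I`, so it holds
    -- automatically.
    obtain ⟨u₁⟩ := (hI Z).2 ((f ≫ j₀) ≫ t) ((g ≫ j₁) ≫ t')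
    exact h.existsUnique_cell t t' μ₀ μ₁ ((u₁.uniq _).trans (u₁.uniq _).symm)

/-- A model bicategory has binary coproducts. -/
theorem ModelStructure.exists_coproduct (M : ModelStructure C) (A B : C) :
    ∃ (P : C) (i₀ : A ⟶ P) (i₁ : B ⟶ P), IsCoproduct i₀ i₁ := by
  obtain ⟨I, hI⟩ := M.exists_initial
  obtain ⟨f⟩ := (hI A).1
  obtain ⟨g⟩ := (hI B).1
  obtain ⟨P, j₀, j₁, φ, h⟩ := M.exists_pushout f g
  exact ⟨P, j₀, j₁, h.isCoproduct hI⟩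

/-- An invertible 2-cell out of a coproduct is given by invertible 2-cells on the summands. -/
theorem IsCoproduct.exists_iso {A B P Z : C} {i₀ : A ⟶ P} {i₁ : B ⟶ P} (h : IsCoproduct i₀ i₁)
    (t t' : P ⟶ Z) (μ₀ : i₀ ≫ t ≅ i₀ ≫ t') (μ₁ : i₁ ≫ t ≅ i₁ ≫ t') :
    ∃ δ : t ≅ t', i₀ ◁ δ.hom = μ₀.hom ∧ i₁ ◁ δ.hom = μ₁.hom := by
  obtain ⟨δ, ⟨h₀, h₁⟩, -⟩ := h.existsUnique_cell t t' μ₀.hom μ₁.hom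
  obtain ⟨δ', ⟨h₀', h₁'⟩, -⟩ := h.existsUnique_cell t' t μ₀.inv μ₁.inv
  -- An endo-2-cell that restricts to identities on both summands is the identity; this is applied
  -- to both composites of `δ` and `δ'`.
  have ext : ∀ {t : P ⟶ Z} (κ : t ⟶ t), i₀ ◁ κ = 𝟙 _ → i₁ ◁ κ = 𝟙 _ → κ = 𝟙 _ :=
    fun {t} κ e₀ e₁ => (h.existsUnique_cell t t (𝟙 _) (𝟙 _)).unique ⟨e₀, e₁⟩
      ⟨whiskerLeft_id _ _, whiskerLeft_id _ _⟩
  exact ⟨⟨δ, δ', ext _ (by rw [whiskerLeft_comp, h₀, h₀', Iso.hom_inv_id])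
    (by rw [whiskerLeft_comp, h₁, h₁', Iso.hom_inv_id]),
    ext _ (by rw [whiskerLeft_comp, h₀, h₀', Iso.inv_hom_id])
    (by rw [whiskerLeft_comp, h₁, h₁', Iso.inv_hom_id])⟩, h₀, h₁⟩

end Coproduct

/-! ### Faithfulness of week equivalences in `Ho M`, and classes of cylinders. -/

section Ho

variable {C : Type u} [Bicategory.{w, v} C] {M : ModelStructure C}

/-- Weak equivalences are faithful in the homotopy bicategory. -/
theorem Ho.whiskerRight_injective_of_weq {A B B' : Ho M} {s : B ⟶ B'} (hs : M.weq s.as)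
    {f g : A ⟶ B} {c c' : f ⟶ g} (h : c ▷ s = c' ▷ s) : c = c' :=
  Cell.ext_hat fun D _ F hF => by
    have e : (Cell.postWhisker c s).hat F hF = (Cell.postWhisker c' s).hat F hF :=
      congrArg (fun t : Cell (f ≫ s) (g ≫ s) => t.hat F hF) h
    -- Once the invertible comparison cells `F.mapComp` are cancelled, faithfulness of composition
    -- with the quasiequivalence `F.map s.as` applies.
    rw [Cell.hat_postWhisker, Cell.hat_postWhisker, cancel_epi, cancel_mono] at e
    obtain ⟨⟨-, h2⟩, -⟩ := hF s.as hs (F.obj A.as)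
    exact (postcomp (F.obj A.as) (F.map s.as)).map_injective e

theorem Ho.cell_comp {X Y : C} {f g k : X ⟶ Y} (μ : f ⟶ g) (ν : g ⟶ k) :
    cell M (μ ≫ ν) = cell M μ ≫ cell M ν :=
  (of_comp (M := M) (f := arr M f) (g := arr M g) (k := arr M k) μ ν).symm

theorem Ho.cell_whiskerRight {X Y Z : C} {f g : X ⟶ Y} (μ : f ⟶ g) (r : Y ⟶ Z) :
    cell M (μ ▷ r) = cell M μ ▷ arr M r :=
  (of_whiskerRight (M := M) (f := arr M f) (g := arr M g) μ (arr M r)).symm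

theorem Ho.cell_whiskerLeft {X Y Z : C} (l : X ⟶ Y) {f g : Y ⟶ Z} (μ : f ⟶ g) :
    cell M (l ◁ μ) = arr M l ◁ cell M μ :=
  (of_whiskerLeft (M := M) (f := arr M f) (g := arr M g) (arr M l) μ).symm

/-- The invertible 2-cell of `Ho(C, W)` between arrows of `C` given by one of `C`. -/
def Ho.cellIso (M : ModelStructure C) {X Y : C} {f g : X ⟶ Y} (e : f ≅ g) : arr M f ≅ arr M g :=
  isoOf (f := arr M f) (g := arr M g) e

/-- The homotopy `d₀ ⇝ d₁` given by the identity of the cylinder. -/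
def SigmaCylinder.homotopy {weq : ∀ ⦃X Y : C⦄, (X ⟶ Y) → Prop} {X : C}
    (K : SigmaCylinder weq X) : SigmaHomotopy weq K.d₀ K.d₁ where
  cyl := K
  h := 𝟙 K.W
  eta := (ρ_ _).inv
  eps := (ρ_ _).hom

theorem SigmaHomotopy.hat_cls {X Y : C} {f g : X ⟶ Y} (H : SigmaHomotopy M.weq f g) {D : Type u}
    [Bicategory.{max u v w, v} D] (F : StrictPseudofunctor C D)
    (hF : Inverts M.weq F.toPseudofunctor) :
    Ho.Cell.hat (A := Ho.mk X) (B := Ho.mk Y) (f := Ho.arr M f) (g := Ho.arr M g) H.cls F hF =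
      H.hat hF := by
  change H.hat hF ≫ 𝟙 _ = _
  rw [Category.comp_id]

/-- The arrow of `K.homotopy` is an identity, so its whiskering is undone by the unitors. Hence the
cell attached to a cylinder by each `F` is the image of one 2-cell of `Ho M`, and later computations
can be done there without mentioning `F`. -/
theorem SigmaCylinder.hat_homotopy {X : C} (K : SigmaCylinder M.weq X) {D : Type u}
    [Bicategory.{max u v w, v} D] (F : StrictPseudofunctor C D)
    (hF : Inverts M.weq F.toPseudofunctor) :
    K.homotopy.hat hF = K.hat hF := by
  have := map_whiskerRight_id_aux F.toPseudofunctor (K.hat hF)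
  have e : K.homotopy.hat hF = F.map₂ (ρ_ K.d₀).inv ≫ ((F.mapComp K.d₀ (𝟙 _)).hom ≫
    K.hat hF ▷ F.map (𝟙 _) ≫ (F.mapComp K.d₁ (𝟙 _)).inv) ≫ F.map₂ (ρ_ K.d₁).hom := by
    simp only [Category.assoc]; rfl
  rw [e, this]
  simp only [Category.assoc, ← F.map₂_comp, ← F.map₂_comp_assoc, Iso.inv_hom_id, F.map₂_id,
      Category.id_comp, Category.comp_id]

/-- The class of a σ-homotopy, expressed by that of its cylinder. -/
theorem SigmaHomotopy.cls_eq {X Y : C} {f g : X ⟶ Y} (H : SigmaHomotopy M.weq f g) :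
    H.cls = Ho.cell M H.eta ≫ H.cyl.homotopy.cls ▷ Ho.arr M H.h ≫ Ho.cell M H.eps :=
  Ho.Cell.ext_hat fun D _ F hF => by
    refine (SigmaHomotopy.hat_cls H F hF).trans (Eq.symm ?_)
    change Ho.Cell.hat ((Ho.Cell.of H.eta : Ho.Cell (Ho.arr M f) (Ho.arr M H.cyl.d₀ ≫ Ho.arr M H.h)).comp
      ((Ho.Cell.postWhisker (f := Ho.arr M H.cyl.d₀) (g := Ho.arr M H.cyl.d₁)
        H.cyl.homotopy.cls (Ho.arr M H.h)).comp
      (Ho.Cell.of H.eps : Ho.Cell (Ho.arr M H.cyl.d₁ ≫ Ho.arr M H.h) (Ho.arr M g)))) F hF = _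
    have e : Ho.Cell.hat (f := Ho.arr M H.cyl.d₀) (g := Ho.arr M H.cyl.d₁)
        H.cyl.homotopy.cls F hF = H.cyl.hat hF :=
      (SigmaHomotopy.hat_cls _ F hF).trans (SigmaCylinder.hat_homotopy _ F hF)
    rw [Ho.Cell.hat_comp, Ho.Cell.hat_comp, Ho.Cell.hat_postWhisker, e, Ho.Cell.hat_of,
      Ho.Cell.hat_of]
    simp only [Category.assoc]
    rfl

/-- The defining property of the class of a σ-cylinder. -/
theorem SigmaCylinder.cls_whiskerRight {X : C} (K : SigmaCylinder M.weq X) :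
    K.homotopy.cls ▷ Ho.arr M K.s = Ho.cell M (K.α₀.hom ≫ K.α₁.inv) :=
  Ho.Cell.ext_hat fun D _ F hF => by
    refine (Ho.Cell.hat_postWhisker F hF _ _).trans (Eq.trans ?_ (Ho.Cell.hat_of F hF _).symm)
    -- The equation characterising the cell of the cylinder, rewritten in terms of the class of
    -- `K.homotopy`; the comparison cells then cancel.
    have e := K.hat_spec hF
    rw [← SigmaCylinder.hat_homotopy, ← SigmaHomotopy.hat_cls] at e
    rw [e]
    simp

end Ho

/-! ### Lifting from cylinders, and pasting identities for the lifted cells. -/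

section Cylinder

variable {C : Type u} [Bicategory.{w, v} C]

/-- Lifting, against a trivial fibration, of an arrow on a cylinder `P ⟶ V` of `A ⨿ A`, with
prescribed restrictions to the two ends. -/
theorem ModelStructure.exists_lift_of_isCoproduct (M : ModelStructure C) {A P V Y B : C}
    {i₀ i₁ : A ⟶ P} (hP : IsCoproduct i₀ i₁) {j : P ⟶ V} (hj : M.cof j) {p : Y ⟶ B}
    (hp : M.fib p) (hp' : M.weq p) (b : V ⟶ B) {u₀ u₁ : A ⟶ Y}
    (ζ₀ : u₀ ≫ p ≅ (i₀ ≫ j) ≫ b) (ζ₁ : u₁ ≫ p ≅ (i₁ ≫ j) ≫ b) :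
    ∃ (f : V ⟶ Y) (r : f ≫ p ≅ b) (E₀ : u₀ ≅ (i₀ ≫ j) ≫ f) (E₁ : u₁ ≅ (i₁ ≫ j) ≫ f),
      E₀.hom ▷ p ≫ (α_ _ _ _).hom ≫ (i₀ ≫ j) ◁ r.hom = ζ₀.hom ∧
      E₁.hom ▷ p ≫ (α_ _ _ _).hom ≫ (i₁ ≫ j) ◁ r.hom = ζ₁.hom := by
  -- The two ends glue to `t : P ⟶ Y`, and `ζ₀`, `ζ₁` glue to an invertible square `γ` from `j` to
  -- `p`; its filler is the required lift.
  obtain ⟨t, ⟨n₀⟩, ⟨n₁⟩⟩ := hP.exists_desc u₀ u₁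
  obtain ⟨γ, h₀, h₁⟩ := hP.exists_iso (t ≫ p) (j ≫ b)
    ((α_ _ _ _).symm ≪≫ whiskerRightIso n₀ p ≪≫ ζ₀ ≪≫ α_ _ _ _)
    ((α_ _ _ _).symm ≪≫ whiskerRightIso n₁ p ≪≫ ζ₁ ≪≫ α_ _ _ _)
  obtain ⟨f, l, r, hf⟩ := (M.lifting j p hj hp (Or.inr hp')).exists_filler t b γ
  -- Restricting the filler equation along `i` gives the equation at that end, with the cell at the
  -- end built from `n` and `l`. Stated for a general `i` to serve both ends.
  have key : ∀ {i : A ⟶ P} {u : A ⟶ Y} (n : i ≫ t ≅ u) (ζ : u ≫ p ≅ (i ≫ j) ≫ b),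
      i ◁ γ.hom = ((α_ _ _ _).symm ≪≫ whiskerRightIso n p ≪≫ ζ ≪≫ α_ _ _ _).hom →
      (n.symm ≪≫ whiskerLeftIso i l ≪≫ (α_ _ _ _).symm).hom ▷ p ≫ (α_ _ _ _).hom ≫
        (i ≫ j) ◁ r.hom = ζ.hom := by
    intro i u n ζ h
    rw [← hf] at h
    simp only [Iso.trans_hom, Iso.symm_hom, whiskerRightIso_hom, whiskerLeftIso_hom,
      whiskerLeft_comp] at h ⊢
    rw [← cancel_epi (n.hom ▷ p), ← cancel_epi (α_ i t p).inv,
      ← cancel_mono (α_ i j b).hom]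
    simp only [Category.assoc]
    rw [← h]
    simp
  exact ⟨f, r, _, _, key n₀ ζ₀ h₀, key n₁ ζ₁ h₁⟩

/-- The 2-cell of a cylinder of `A` over a cylinder of `X`, after composing with the projection
of the latter. -/
theorem whiskerRight_cylinder_cell {A X W V : C} {q : A ⟶ X} {d₀ d₁ : X ⟶ W} {s : W ⟶ X}
    {δ : d₀ ⟶ d₁} {D₀ D₁ : A ⟶ V} {m : V ⟶ W} {t : V ⟶ A} (r : t ≫ q ≅ m ≫ s)
    (e₀ : D₀ ≫ m ≅ q ≫ d₀) (e₁ : D₁ ≫ m ≅ q ≫ d₁) (α₀ : d₀ ≫ s ≅ 𝟙 X) (α₁ : d₁ ≫ s ≅ 𝟙 X)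
    (E₀ : 𝟙 A ≅ D₀ ≫ t) (E₁ : 𝟙 A ≅ D₁ ≫ t) {κ : D₀ ⟶ D₁}
    (h₀ : E₀.hom ▷ q ≫ (α_ _ _ _).hom ≫ D₀ ◁ r.hom = (λ_ q).hom ≫ (ρ_ q).inv ≫ q ◁ α₀.inv ≫
      (α_ _ _ _).inv ≫ e₀.inv ▷ s ≫ (α_ _ _ _).hom)
    (h₁ : E₁.hom ▷ q ≫ (α_ _ _ _).hom ≫ D₁ ◁ r.hom = (λ_ q).hom ≫ (ρ_ q).inv ≫ q ◁ α₁.inv ≫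
      (α_ _ _ _).inv ≫ e₁.inv ▷ s ≫ (α_ _ _ _).hom)
    (hδ : δ ▷ s = α₀.hom ≫ α₁.inv) (hκ : κ ▷ t = E₀.inv ≫ E₁.hom) :
    (κ ▷ m) ▷ s = (e₀.hom ≫ q ◁ δ ≫ e₁.inv) ▷ s := by
  -- Interchange with `r` trades `m ≫ s` for `t ≫ q`, and `κ ▷ t` is known from `hκ`.
  have e : κ ▷ (m ≫ s) = D₀ ◁ r.inv ≫ κ ▷ (t ≫ q) ≫ D₁ ◁ r.hom := by
    rw [← whisker_exchange, ← whiskerLeft_comp_assoc, r.inv_hom_id, whiskerLeft_id,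
      Category.id_comp]
  have hq : (κ ▷ t) ▷ q = E₀.inv ▷ q ≫ E₁.hom ▷ q := by rw [hκ, comp_whiskerRight]
  have hs : (q ◁ δ) ▷ s = (α_ _ _ _).hom ≫ q ◁ (α₀.hom ≫ α₁.inv) ≫ (α_ _ _ _).inv := by
    rw [whisker_assoc, hδ]
  -- `h₀` solved for the inverse of `E₀`, the form in which that end enters `hκ`.
  have h₀' : (α_ _ _ _).inv ≫ E₀.inv ▷ q = D₀ ◁ r.hom ≫ (α_ _ _ _).inv ≫ e₀.hom ▷ s ≫
      (α_ _ _ _).hom ≫ q ◁ α₀.hom ≫ (ρ_ q).hom ≫ (λ_ q).inv := by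
    rw [← cancel_epi (α_ D₀ t q).hom, ← cancel_epi (E₀.hom ▷ q), reassoc_of% h₀]
    simp
  have hm : (κ ▷ m) ▷ s = (α_ _ _ _).hom ≫ κ ▷ (m ≫ s) ≫ (α_ _ _ _).inv := by simp
  have ht : κ ▷ (t ≫ q) = (α_ _ _ _).inv ≫ (κ ▷ t) ▷ q ≫ (α_ _ _ _).hom := by simp
  rw [hm, e, ht, hq]
  simp only [comp_whiskerRight, hs, Category.assoc]
  rw [reassoc_of% h₀', reassoc_of% h₁]
  simp

/-- The 2-cell of a homotopy over a given one. -/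
theorem whiskerRight_homotopy_cell {A X W V Y Y' : C} {q : A ⟶ X} {p : Y' ⟶ Y}
    {d₀ d₁ : X ⟶ W} {δ : d₀ ⟶ d₁} {D₀ D₁ : A ⟶ V} {m : V ⟶ W} {κ : D₀ ⟶ D₁}
    (e₀ : D₀ ≫ m ≅ q ≫ d₀) (e₁ : D₁ ≫ m ≅ q ≫ d₁)
    {f g : X ⟶ Y} {u v : A ⟶ Y'} (a : u ≫ p ≅ q ≫ f) (b : v ≫ p ≅ q ≫ g)
    {h : W ⟶ Y} (eta : f ≅ d₀ ≫ h) (eps : d₁ ≫ h ≅ g) {k : V ⟶ Y'} (r : k ≫ p ≅ m ≫ h)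
    (E₀ : u ≅ D₀ ≫ k) (E₁ : v ≅ D₁ ≫ k)
    (h₀ : E₀.hom ▷ p ≫ (α_ _ _ _).hom ≫ D₀ ◁ r.hom = a.hom ≫ q ◁ eta.hom ≫
      (α_ _ _ _).inv ≫ e₀.inv ▷ h ≫ (α_ _ _ _).hom)
    (h₁ : E₁.hom ▷ p ≫ (α_ _ _ _).hom ≫ D₁ ◁ r.hom = b.hom ≫ q ◁ eps.inv ≫
      (α_ _ _ _).inv ≫ e₁.inv ▷ h ≫ (α_ _ _ _).hom)
    (hκ : κ ▷ m = e₀.hom ≫ q ◁ δ ≫ e₁.inv) :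
    (E₀.hom ≫ κ ▷ k ≫ E₁.inv) ▷ p = a.hom ≫ q ◁ (eta.hom ≫ δ ▷ h ≫ eps.hom) ≫ b.inv := by
  have h₁' : (α_ _ _ _).inv ≫ E₁.inv ▷ p = D₁ ◁ r.hom ≫ (α_ _ _ _).inv ≫ e₁.hom ▷ h ≫
      (α_ _ _ _).hom ≫ q ◁ eps.hom ≫ b.inv := by
    rw [← cancel_epi (α_ D₁ k p).hom, ← cancel_epi (E₁.hom ▷ p), reassoc_of% h₁]
    simp
  have hk : (κ ▷ k) ▷ p = (α_ _ _ _).hom ≫ κ ▷ (k ≫ p) ≫ (α_ _ _ _).inv := by simp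
  have hm : κ ▷ (m ≫ h) = (α_ _ _ _).inv ≫ (κ ▷ m) ▷ h ≫ (α_ _ _ _).hom := by simp
  simp only [comp_whiskerRight, hk, Category.assoc]
  -- Sliding `κ` past `r` replaces `k ≫ p` by `m ≫ h`, where `hκ` applies.
  rw [h₁', ← whisker_exchange_assoc, reassoc_of% h₀, hm, hκ]
  simp

end Cylinder

/-! ### Lifting a homotopy along trivial fibrations. -/

section Lift

variable {C : Type u} [Bicategory.{w, v} C] {M : ModelStructure C}

/-- A homotopy between arrows of `X` can be lifted along trivial fibrations `q : A ⟶ X` and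
`p : Y' ⟶ Y`. -/
theorem InvWHomotopy.exists_lift {A X Y Y' : C} {q : A ⟶ X} (hq : M.fib q) (hq' : M.weq q)
    {p : Y' ⟶ Y} (hp : M.fib p) (hp' : M.weq p) {f g : X ⟶ Y} (H : InvWHomotopy M f g)
    {u v : A ⟶ Y'} (a : u ≫ p ≅ q ≫ f) (b : v ≫ p ≅ q ≫ g) :
    ∃ K : InvWHomotopy M u v, K.cls ▷ Ho.arr M p =
      Ho.cell M a.hom ≫ Ho.arr M q ◁ H.cls ≫ Ho.cell M b.inv := by
  obtain ⟨cyl, h, eta, eps, heta, heps⟩ := H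
  obtain ⟨W, d₀, d₁, s, hs, α₀, α₁, -⟩ := cyl
  dsimp only at h eta eps heta heps
  -- The new cylinder `V` of `A` lies over `W` by a trivial fibration `m`; the factorization also
  -- makes its ends jointly a cofibration.
  obtain ⟨P, i₀, i₁, hP⟩ := M.exists_coproduct A A
  obtain ⟨t, ⟨n₀⟩, ⟨n₁⟩⟩ := hP.exists_desc (q ≫ d₀) (q ≫ d₁)
  obtain ⟨V, j, m, hj, -, hm, ⟨τ⟩⟩ := M.exists_fac_trivFib t
  let e₀ : (i₀ ≫ j) ≫ m ≅ q ≫ d₀ := α_ _ _ _ ≪≫ whiskerLeftIso i₀ τ.symm ≪≫ n₀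
  let e₁ : (i₁ ≫ j) ≫ m ≅ q ≫ d₁ := α_ _ _ _ ≪≫ whiskerLeftIso i₁ τ.symm ≪≫ n₁
  -- The projection `σ` lifts `m ≫ s` through `q`. At either end `m ≫ s` restricts to `q` up to
  -- isomorphism, so both ends can be prescribed to be `𝟙 A`.
  obtain ⟨σ, r, E₀, E₁, h₀, h₁⟩ := M.exists_lift_of_isCoproduct hP hj hq hq' (m ≫ s)
    (λ_ q ≪≫ (ρ_ q).symm ≪≫ whiskerLeftIso q α₀.symm ≪≫ (α_ _ _ _).symm ≪≫
      whiskerRightIso e₀.symm s ≪≫ α_ _ _ _)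
    (λ_ q ≪≫ (ρ_ q).symm ≪≫ whiskerLeftIso q α₁.symm ≪≫ (α_ _ _ _).symm ≪≫
      whiskerRightIso e₁.symm s ≪≫ α_ _ _ _)
  -- The homotopy `k` lifts `m ≫ h` through `p`, with ends prescribed to be `u` and `v`.
  obtain ⟨k, r', E₀', E₁', h₀', h₁'⟩ := M.exists_lift_of_isCoproduct hP hj hp hp' (m ≫ h)
    (a ≪≫ whiskerLeftIso q (asIso eta) ≪≫ (α_ _ _ _).symm ≪≫
      whiskerRightIso e₀.symm h ≪≫ α_ _ _ _)
    (b ≪≫ whiskerLeftIso q (asIso eps).symm ≪≫ (α_ _ _ _).symm ≪≫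
      whiskerRightIso e₁.symm h ≪≫ α_ _ _ _)
  -- Three for two in `σ ≫ q ≅ m ≫ s`.
  have hσ : M.weq σ :=
    M.weq_of_comp_right σ q _ r hq' (M.weq_comp m s _ (Iso.refl _) hm hs)
  let L : WCylinder M A :=
    { W := V, d₀ := i₀ ≫ j, d₁ := i₁ ≫ j, s := σ, weq_s := hσ, α₀ := E₀.symm, α₁ := E₁.symm
      cof_d := ⟨P, i₀, i₁, hP, j, ⟨Iso.refl _⟩, ⟨Iso.refl _⟩, hj⟩ }
  refine ⟨⟨L, k, E₀'.hom, E₁'.inv, inferInstance, inferInstance⟩, ?_⟩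
  let S : SigmaCylinder M.weq X := ⟨W, X, d₀, d₁, 𝟙 X, s, hs, α₀, α₁⟩
  simp only [Iso.trans_hom, Iso.symm_hom, whiskerRightIso_hom, whiskerLeftIso_hom,
    asIso_hom, asIso_inv] at h₀ h₁ h₀' h₁'
  have hL := L.toSigma.cls_whiskerRight
  have hS := S.cls_whiskerRight
  replace h₀ := congrArg (Ho.cell M) h₀
  replace h₁ := congrArg (Ho.cell M) h₁
  replace h₀' := congrArg (Ho.cell M) h₀'
  replace h₁' := congrArg (Ho.cell M) h₁'
  simp only [Ho.cell_comp, Ho.cell_whiskerLeft, Ho.cell_whiskerRight] at hL hS h₀ h₁ h₀' h₁'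
  -- The universal homotopy of `V` lies over that of `W`. This is tested after composing with `s`,
  -- which is faithful in `Ho M`.
  have key : L.toSigma.homotopy.cls ▷ Ho.arr M m = (Ho.cellIso M e₀).hom ≫
      Ho.arr M q ◁ S.homotopy.cls ≫ (Ho.cellIso M e₁).inv :=
    Ho.whiskerRight_injective_of_weq (s := Ho.arr M s) hs
      (whiskerRight_cylinder_cell (q := Ho.arr M q) (d₀ := Ho.arr M d₀) (d₁ := Ho.arr M d₁)
        (s := Ho.arr M s) (D₀ := Ho.arr M (i₀ ≫ j)) (D₁ := Ho.arr M (i₁ ≫ j)) (m := Ho.arr M m)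
        (t := Ho.arr M σ) (δ := S.homotopy.cls) (κ := L.toSigma.homotopy.cls) (Ho.cellIso M r) (Ho.cellIso M e₀) (Ho.cellIso M e₁)
        (Ho.cellIso M α₀) (Ho.cellIso M α₁) (Ho.cellIso M E₀) (Ho.cellIso M E₁) h₀ h₁ hS hL)
  refine (congrArg (· ▷ Ho.arr M p) (SigmaHomotopy.cls_eq _)).trans (Eq.trans ?_
    (congrArg (fun c => Ho.cell M a.hom ≫ Ho.arr M q ◁ c ≫ Ho.cell M b.inv)
      (SigmaHomotopy.cls_eq _)).symm)
  exact whiskerRight_homotopy_cell (q := Ho.arr M q) (p := Ho.arr M p) (d₀ := Ho.arr M d₀)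
    (d₁ := Ho.arr M d₁) (D₀ := Ho.arr M (i₀ ≫ j)) (D₁ := Ho.arr M (i₁ ≫ j)) (m := Ho.arr M m)
    (δ := S.homotopy.cls) (κ := L.toSigma.homotopy.cls) (f := Ho.arr M f) (g := Ho.arr M g)
    (u := Ho.arr M u) (v := Ho.arr M v) (h := Ho.arr M h) (k := Ho.arr M k) (Ho.cellIso M e₀) (Ho.cellIso M e₁) (Ho.cellIso M a)
    (Ho.cellIso M b) (Ho.cellIso M (asIso eta)) (Ho.cellIso M (asIso eps)) (Ho.cellIso M r')
    (Ho.cellIso M E₀') (Ho.cellIso M E₁') h₀' h₁' key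

end Lift

/-! ### Pasting identities over the projections, in an arbitrary bicategory. -/

section Chase

variable {D : Type u} [Bicategory.{w, v} D]

/-- The left unit equation after composing with the projection. -/
theorem whiskerRight_left_unit_cell {X Y X' Y' : D} {p : X' ⟶ X} {r : Y' ⟶ Y} {f : X ⟶ X}
    {g : X ⟶ Y} {f' : X' ⟶ X'} {g' : X' ⟶ Y'} (φ : f' ≫ p ≅ p ≫ f) (ψ : g' ≫ r ≅ p ≫ g)
    {H₁ : 𝟙 X ⟶ f} {H₂ : f ≫ g ⟶ g} {K₁ : 𝟙 X' ⟶ f'} {K₂ : f' ≫ g' ⟶ g'}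
    (h₁ : K₁ ▷ p = (λ_ p).hom ≫ (ρ_ p).inv ≫ p ◁ H₁ ≫ φ.inv)
    (h₂ : K₂ ▷ r = (α_ _ _ _).hom ≫ f' ◁ ψ.hom ≫ (α_ _ _ _).inv ≫ φ.hom ▷ g ≫
      (α_ _ _ _).hom ≫ p ◁ H₂ ≫ ψ.inv)
    (h : H₁ ▷ g ≫ H₂ = (λ_ g).hom) : (K₁ ▷ g' ≫ K₂) ▷ r = (λ_ g').hom ▷ r := by
  -- `K₁` slides past `ψ` so as to act on `p ≫ g`, where its projection `h₁` can be substituted.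
  have e : (K₁ ▷ g') ▷ r ≫ (α_ _ _ _).hom ≫ f' ◁ ψ.hom =
      (α_ _ _ _).hom ≫ 𝟙 _ ◁ ψ.hom ≫ K₁ ▷ (p ≫ g) := by
    rw [whisker_exchange, whiskerRight_comp, Category.assoc, Category.assoc]
    simp
  have e' : K₁ ▷ (p ≫ g) ≫ (α_ _ _ _).inv = (α_ _ _ _).inv ≫ (K₁ ▷ p) ▷ g := by simp
  have e'' : p ◁ (H₁ ▷ g) ≫ p ◁ H₂ = p ◁ (λ_ g).hom := by rw [← whiskerLeft_comp, h]
  rw [comp_whiskerRight, h₂, reassoc_of% e, reassoc_of% e', h₁]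
  simp [reassoc_of% e'']

/-- The right unit equation after composing with the projection. -/
theorem whiskerRight_right_unit_cell {X Y X' Y' : D} {p : X' ⟶ X} {r : Y' ⟶ Y} {f : X ⟶ Y}
    {g : Y ⟶ Y} {f' : X' ⟶ Y'} {g' : Y' ⟶ Y'} (φ : f' ≫ r ≅ p ≫ f) (ψ : g' ≫ r ≅ r ≫ g)
    {H₁ : 𝟙 Y ⟶ g} {H₂ : f ≫ g ⟶ f} {K₁ : 𝟙 Y' ⟶ g'} {K₂ : f' ≫ g' ⟶ f'}
    (h₁ : K₁ ▷ r = (λ_ r).hom ≫ (ρ_ r).inv ≫ r ◁ H₁ ≫ ψ.inv)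
    (h₂ : K₂ ▷ r = (α_ _ _ _).hom ≫ f' ◁ ψ.hom ≫ (α_ _ _ _).inv ≫ φ.hom ▷ g ≫
      (α_ _ _ _).hom ≫ p ◁ H₂ ≫ φ.inv)
    (h : f ◁ H₁ ≫ H₂ = (ρ_ f).hom) : (f' ◁ K₁ ≫ K₂) ▷ r = (ρ_ f').hom ▷ r := by
  -- `H₁` slides past `φ` and becomes adjacent to `p ◁ H₂`, where `h` applies.
  have e : f' ◁ (r ◁ H₁) ≫ (α_ _ _ _).inv ≫ φ.hom ▷ g =
      (α_ _ _ _).inv ≫ φ.hom ▷ 𝟙 _ ≫ (p ≫ f) ◁ H₁ := by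
    rw [← whisker_exchange]
    simp
  have e'' : p ◁ (f ◁ H₁) ≫ p ◁ H₂ = p ◁ (ρ_ f).hom := by rw [← whiskerLeft_comp, h]
  rw [comp_whiskerRight, h₂, whisker_assoc, h₁]
  simp only [whiskerLeft_comp, Category.assoc, Iso.inv_hom_id_assoc,
    whiskerLeft_inv_hom_assoc]
  rw [reassoc_of% e]
  simp [reassoc_of% e'']

/-- The associativity equation after composing with the projection. -/
theorem whiskerRight_assoc_cell {X Y Z W X' Y' Z' W' : D} {p : X' ⟶ X} {q : Y' ⟶ Y}
    {r : Z' ⟶ Z} {s : W' ⟶ W} {f : X ⟶ Y} {g : Y ⟶ Z} {h : Z ⟶ W} {l : X ⟶ W}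
    {k : X ⟶ Z} {m : Y ⟶ W}
    {f' : X' ⟶ Y'} {g' : Y' ⟶ Z'} {h' : Z' ⟶ W'} {l' : X' ⟶ W'} {k' : X' ⟶ Z'} {m' : Y' ⟶ W'}
    (φ : f' ≫ q ≅ p ≫ f) (ψ : g' ≫ r ≅ q ≫ g) (χ : h' ≫ s ≅ r ≫ h) (ω : l' ≫ s ≅ p ≫ l)
    (κ : k' ≫ r ≅ p ≫ k) (μ : m' ≫ s ≅ q ≫ m)
    {H₁ : f ≫ g ⟶ k} {H₂ : g ≫ h ⟶ m} {H₃ : k ≫ h ⟶ l} {H₄ : f ≫ m ⟶ l}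
    {K₁ : f' ≫ g' ⟶ k'} {K₂ : g' ≫ h' ⟶ m'} {K₃ : k' ≫ h' ⟶ l'} {K₄ : f' ≫ m' ⟶ l'}
    (h₁ : K₁ ▷ r = (α_ _ _ _).hom ≫ f' ◁ ψ.hom ≫ (α_ _ _ _).inv ≫ φ.hom ▷ g ≫
      (α_ _ _ _).hom ≫ p ◁ H₁ ≫ κ.inv)
    (h₂ : K₂ ▷ s = (α_ _ _ _).hom ≫ g' ◁ χ.hom ≫ (α_ _ _ _).inv ≫ ψ.hom ▷ h ≫
      (α_ _ _ _).hom ≫ q ◁ H₂ ≫ μ.inv)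
    (h₃ : K₃ ▷ s = (α_ _ _ _).hom ≫ k' ◁ χ.hom ≫ (α_ _ _ _).inv ≫ κ.hom ▷ h ≫
      (α_ _ _ _).hom ≫ p ◁ H₃ ≫ ω.inv)
    (h₄ : K₄ ▷ s = (α_ _ _ _).hom ≫ f' ◁ μ.hom ≫ (α_ _ _ _).inv ≫ φ.hom ▷ m ≫
      (α_ _ _ _).hom ≫ p ◁ H₄ ≫ ω.inv)
    (e : (α_ f g h).hom ≫ f ◁ H₂ ≫ H₄ = H₁ ▷ h ≫ H₃) :
    ((α_ f' g' h').hom ≫ f' ◁ K₂ ≫ K₄) ▷ s = (K₁ ▷ h' ≫ K₃) ▷ s := by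
  -- On one side `K₁` slides past `χ` to meet `r`; on the other, in `e₃`, `H₂` slides past `φ` to
  -- meet `H₄`. After substitution `κ` and `μ` cancel against their inverses, leaving `e` whiskered
  -- by `p`.
  have e₁ : (K₁ ▷ h') ▷ s ≫ (α_ _ _ _).hom ≫ k' ◁ χ.hom =
      (α_ _ _ _).hom ≫ (f' ≫ g') ◁ χ.hom ≫ K₁ ▷ (r ≫ h) := by
    rw [whisker_exchange]; simp
  have e₂ : K₁ ▷ (r ≫ h) ≫ (α_ _ _ _).inv = (α_ _ _ _).inv ≫ (K₁ ▷ r) ▷ h := by simp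
  have e₃ : f' ◁ (q ◁ H₂) ≫ (α_ _ _ _).inv ≫ φ.hom ▷ m =
      (α_ _ _ _).inv ≫ φ.hom ▷ (g ≫ h) ≫ (p ≫ f) ◁ H₂ := by
    rw [← whisker_exchange]; simp
  have e₄ := congrArg (p ◁ ·) e
  simp only [whiskerLeft_comp] at e₄
  have e₅ : p ◁ (f ◁ H₂) ≫ p ◁ H₄ = p ◁ (α_ f g h).inv ≫ p ◁ (H₁ ▷ h) ≫ p ◁ H₃ := by
    rw [← e₄, whiskerLeft_inv_hom_assoc]
  simp only [comp_whiskerRight]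
  rw [h₄, h₃, reassoc_of% e₁, reassoc_of% e₂, h₁, whisker_assoc, h₂]
  simp only [whiskerLeft_comp, Category.assoc, Iso.inv_hom_id_assoc,
    whiskerLeft_inv_hom_assoc]
  rw [reassoc_of% e₃]
  simp [reassoc_of% e₅]

/-- The naturality equation after composing with the projection. -/
theorem whiskerRight_naturality_cell {X Y Z X' Y' Z' : D} {p : X' ⟶ X} {q : Y' ⟶ Y}
    {r : Z' ⟶ Z} {f₁ f₂ : X ⟶ Y} {g₁ g₂ : Y ⟶ Z} {l₁ l₂ : X ⟶ Z}
    {f₁' f₂' : X' ⟶ Y'} {g₁' g₂' : Y' ⟶ Z'} {l₁' l₂' : X' ⟶ Z'}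
    (φ₁ : f₁' ≫ q ≅ p ≫ f₁) (φ₂ : f₂' ≫ q ≅ p ≫ f₂) (ψ₁ : g₁' ≫ r ≅ q ≫ g₁)
    (ψ₂ : g₂' ≫ r ≅ q ≫ g₂) (ω₁ : l₁' ≫ r ≅ p ≫ l₁) (ω₂ : l₂' ≫ r ≅ p ≫ l₂)
    {α : f₁ ⟶ f₂} {β : g₁ ⟶ g₂} {γ : l₁ ⟶ l₂} {α' : f₁' ⟶ f₂'} {β' : g₁' ⟶ g₂'}
    {γ' : l₁' ⟶ l₂'} (hα : α' ▷ q = φ₁.hom ≫ p ◁ α ≫ φ₂.inv)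
    (hβ : β' ▷ r = ψ₁.hom ≫ q ◁ β ≫ ψ₂.inv) (hγ : γ' ▷ r = ω₁.hom ≫ p ◁ γ ≫ ω₂.inv)
    {H₁ : f₁ ≫ g₁ ⟶ l₁} {H₂ : f₂ ≫ g₂ ⟶ l₂} {K₁ : f₁' ≫ g₁' ⟶ l₁'} {K₂ : f₂' ≫ g₂' ⟶ l₂'}
    (h₁ : K₁ ▷ r = (α_ _ _ _).hom ≫ f₁' ◁ ψ₁.hom ≫ (α_ _ _ _).inv ≫ φ₁.hom ▷ g₁ ≫
      (α_ _ _ _).hom ≫ p ◁ H₁ ≫ ω₁.inv)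
    (h₂ : K₂ ▷ r = (α_ _ _ _).hom ≫ f₂' ◁ ψ₂.hom ≫ (α_ _ _ _).inv ≫ φ₂.hom ▷ g₂ ≫
      (α_ _ _ _).hom ≫ p ◁ H₂ ≫ ω₂.inv)
    (e : α ▷ g₁ ≫ f₂ ◁ β ≫ H₂ = H₁ ≫ γ) :
    (α' ▷ g₁' ≫ f₂' ◁ β' ≫ K₂) ▷ r = (K₁ ≫ γ') ▷ r := by
  -- `α'` slides past `ψ₁` to be projected by `hα`; in `e₃`, `β` slides past `φ₂`. Then `α`, `β` and
  -- `H₂` are consecutive and `e` applies.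
  have e₁ : (α' ▷ g₁') ▷ r ≫ (α_ _ _ _).hom ≫ f₂' ◁ ψ₁.hom =
      (α_ _ _ _).hom ≫ f₁' ◁ ψ₁.hom ≫ α' ▷ (q ≫ g₁) := by
    rw [whisker_exchange]; simp
  have e₂ : α' ▷ (q ≫ g₁) = (α_ _ _ _).inv ≫ (α' ▷ q) ▷ g₁ ≫ (α_ _ _ _).hom := by simp
  have e₃ : f₂' ◁ (q ◁ β) ≫ (α_ _ _ _).inv ≫ φ₂.hom ▷ g₂ =
      (α_ _ _ _).inv ≫ φ₂.hom ▷ g₁ ≫ (p ≫ f₂) ◁ β := by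
    rw [← whisker_exchange]; simp
  have e₄ := congrArg (p ◁ ·) e
  simp only [whiskerLeft_comp] at e₄
  simp only [comp_whiskerRight]
  rw [h₁, h₂, hγ, whisker_assoc, hβ]
  simp only [whiskerLeft_comp, Category.assoc, Iso.inv_hom_id_assoc,
    whiskerLeft_inv_hom_assoc]
  rw [reassoc_of% e₁, e₂, hα, reassoc_of% e₃]
  simp [reassoc_of% e₄]

end Chase

/-! ### The replacement seen in `Ho M`, and the lemma itself. -/

/-- The invertible 2-cell `ρ_f` in `Ho(C, W)`. -/
def CofibrantReplacement.hoρ {C : Type u} [Bicategory.{w, v} C] {M : ModelStructure C}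
    (Q : CofibrantReplacement M) {X Y : C} (f : X ⟶ Y) :
    Ho.arr M (Q.map f) ≫ Ho.arr M (Q.p Y) ≅ Ho.arr M (Q.p X) ≫ Ho.arr M f :=
  Ho.cellIso M (Q.ρ f)

theorem CofibrantReplacement.cell_map₂_whiskerRight_p {C : Type u} [Bicategory.{w, v} C]
    {M : ModelStructure C} (Q : CofibrantReplacement M) {X Y : C} {f g : X ⟶ Y} (μ : f ⟶ g) :
    Ho.cell M (Q.map₂ μ) ▷ Ho.arr M (Q.p Y) = (Q.hoρ f).hom ≫
      Ho.arr M (Q.p X) ◁ Ho.cell M μ ≫ (Q.hoρ g).inv := by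
  have e := congrArg (Ho.cell M) (Q.map₂_whiskerRight_p μ)
  simp only [Ho.cell_comp, Ho.cell_whiskerLeft, Ho.cell_whiskerRight] at e
  exact e

end ModelBicat

/-- Existence of `ξ_Q H` and `φ_Q H` and their compatibility with `p` (first two items), and the
unit, associativity and naturality equations, valid for all admissible choices of them. -/
theorem lemma4p10 {C : Type u} [Bicategory.{w, v} C] (M : ModelStructure C)
    (Q : CofibrantReplacement M) :
    -- 1. existence of `ξ_Q H`
    (∀ {X : C} {f : X ⟶ X} (H : InvWHomotopy M (𝟙 X) f),
      ∃ K : InvWHomotopy M (𝟙 (Q.obj X)) (Q.map f), Q.IsXi H K) ∧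
    -- 2. existence of `φ_Q H`
    (∀ {X Y Z : C} {f : X ⟶ Y} {g : Y ⟶ Z} {l : X ⟶ Z} (H : InvWHomotopy M (f ≫ g) l),
      ∃ K : InvWHomotopy M (Q.map f ≫ Q.map g) (Q.map l), Q.IsPhi H K) ∧
    -- 3. first unit equation
    (∀ {X Y : C} {f : X ⟶ X} {g : X ⟶ Y}
      (H₁ : InvWHomotopy M (𝟙 X) f) (H₂ : InvWHomotopy M (f ≫ g) g)
      (K₁ : InvWHomotopy M (𝟙 (Q.obj X)) (Q.map f))
      (K₂ : InvWHomotopy M (Q.map f ≫ Q.map g) (Q.map g)),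
      Q.IsXi H₁ K₁ → Q.IsPhi H₂ K₂ →
      H₁.cls ▷ Ho.arr M g ≫ H₂.cls = (λ_ (Ho.arr M g)).hom →
      K₁.cls ▷ Ho.arr M (Q.map g) ≫ K₂.cls =
        (λ_ (Ho.arr M (Q.map g))).hom) ∧
    -- 4. second unit equation
    (∀ {X Y : C} {f : X ⟶ Y} {g : Y ⟶ Y}
      (H₁ : InvWHomotopy M (𝟙 Y) g) (H₂ : InvWHomotopy M (f ≫ g) f)
      (K₁ : InvWHomotopy M (𝟙 (Q.obj Y)) (Q.map g))
      (K₂ : InvWHomotopy M (Q.map f ≫ Q.map g) (Q.map f)),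
      Q.IsXi H₁ K₁ → Q.IsPhi H₂ K₂ →
      Ho.arr M f ◁ H₁.cls ≫ H₂.cls = (ρ_ (Ho.arr M f)).hom →
      Ho.arr M (Q.map f) ◁ K₁.cls ≫ K₂.cls =
        (ρ_ (Ho.arr M (Q.map f))).hom) ∧
    -- 5. associativity equation (`l` is `h ∗ g ∗ f`, with any bracketing)
    (∀ {X Y Z W : C} {f : X ⟶ Y} {g : Y ⟶ Z} {h : Z ⟶ W} {l : X ⟶ W}
      (H₁ : InvWHomotopy M (f ≫ g) (f ≫ g))
      (H₂ : InvWHomotopy M (g ≫ h) (g ≫ h))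
      (H₃ : InvWHomotopy M ((f ≫ g) ≫ h) l)
      (H₄ : InvWHomotopy M (f ≫ (g ≫ h)) l)
      (K₁ : InvWHomotopy M (Q.map f ≫ Q.map g) (Q.map (f ≫ g)))
      (K₂ : InvWHomotopy M (Q.map g ≫ Q.map h) (Q.map (g ≫ h)))
      (K₃ : InvWHomotopy M (Q.map (f ≫ g) ≫ Q.map h) (Q.map l))
      (K₄ : InvWHomotopy M (Q.map f ≫ Q.map (g ≫ h)) (Q.map l)),
      Q.IsPhi H₁ K₁ → Q.IsPhi H₂ K₂ → Q.IsPhi H₃ K₃ → Q.IsPhi H₄ K₄ →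
      (α_ (Ho.arr M f) (Ho.arr M g) (Ho.arr M h)).hom ≫
          Ho.arr M f ◁ H₂.cls ≫ H₄.cls =
        H₁.cls ▷ Ho.arr M h ≫ H₃.cls →
      (α_ (Ho.arr M (Q.map f)) (Ho.arr M (Q.map g))
            (Ho.arr M (Q.map h))).hom ≫
          Ho.arr M (Q.map f) ◁ K₂.cls ≫ K₄.cls =
        K₁.cls ▷ Ho.arr M (Q.map h) ≫ K₃.cls) ∧
    -- 6. naturality equation
    (∀ {X Y Z : C} {f₁ f₂ : X ⟶ Y} {g₁ g₂ : Y ⟶ Z} {l₁ l₂ : X ⟶ Z}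
      (α : f₁ ⟶ f₂) (β : g₁ ⟶ g₂) (γ : l₁ ⟶ l₂)
      (H₁ : InvWHomotopy M (f₁ ≫ g₁) l₁) (H₂ : InvWHomotopy M (f₂ ≫ g₂) l₂)
      (K₁ : InvWHomotopy M (Q.map f₁ ≫ Q.map g₁) (Q.map l₁))
      (K₂ : InvWHomotopy M (Q.map f₂ ≫ Q.map g₂) (Q.map l₂)),
      Q.IsPhi H₁ K₁ → Q.IsPhi H₂ K₂ →
      Ho.cell M α ▷ Ho.arr M g₁ ≫
          Ho.arr M f₂ ◁ Ho.cell M β ≫ H₂.cls =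
        H₁.cls ≫ Ho.cell M γ →
      Ho.cell M (Q.map₂ α) ▷ Ho.arr M (Q.map g₁) ≫
          Ho.arr M (Q.map f₂) ◁ Ho.cell M (Q.map₂ β) ≫ K₂.cls =
        K₁.cls ≫ Ho.cell M (Q.map₂ γ)) := by
  refine ⟨?_, ?_, ?_, ?_, ?_, ?_⟩
  · intro X f H
    -- Both trivial fibrations are `Q.p X`; the identity of `Q.obj X` lies over `Q.p X ≫ 𝟙 X` by
    -- unitors.
    obtain ⟨K, hK⟩ := H.exists_lift (Q.fib_p X) (Q.weq_p X) (Q.fib_p X) (Q.weq_p X)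
      (λ_ (Q.p X) ≪≫ (ρ_ (Q.p X)).symm) (Q.ρ f)
    refine ⟨K, hK.trans ?_⟩
    rw [Iso.trans_hom, Ho.cell_comp, Category.assoc]
    rfl
  · intro X Y Z f g l H
    -- `Q.map f ≫ Q.map g` lies over `Q.p X ≫ f ≫ g` by pasting `Q.ρ g` and `Q.ρ f`.
    obtain ⟨K, hK⟩ := H.exists_lift (Q.fib_p X) (Q.weq_p X) (Q.fib_p Z) (Q.weq_p Z)
      (α_ _ _ _ ≪≫ whiskerLeftIso (Q.map f) (Q.ρ g) ≪≫ (α_ _ _ _).symm ≪≫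
        whiskerRightIso (Q.ρ f) g ≪≫ α_ _ _ _) (Q.ρ l)
    refine ⟨K, hK.trans ?_⟩
    simp only [Iso.trans_hom, Iso.symm_hom, whiskerLeftIso_hom, whiskerRightIso_hom,
      Ho.cell_comp, Ho.cell_whiskerLeft, Ho.cell_whiskerRight, Category.assoc]
    rfl
  · intro X Y f g H₁ H₂ K₁ K₂ h₁ h₂ h
    -- Here and below, `IsXi` and `IsPhi` unfold to the projection hypotheses of the pasting
    -- identities, the components of `Q.hoρ` being those of `Q.ρ` by definition.
    exact Ho.whiskerRight_injective_of_weq (s := Ho.arr M (Q.p Y)) (Q.weq_p Y)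
      (whiskerRight_left_unit_cell (Q.hoρ f) (Q.hoρ g) h₁ h₂ h)
  · intro X Y f g H₁ H₂ K₁ K₂ h₁ h₂ h
    exact Ho.whiskerRight_injective_of_weq (s := Ho.arr M (Q.p Y)) (Q.weq_p Y)
      (whiskerRight_right_unit_cell (Q.hoρ f) (Q.hoρ g) h₁ h₂ h)
  · intro X Y Z W f g h l H₁ H₂ H₃ H₄ K₁ K₂ K₃ K₄ h₁ h₂ h₃ h₄ e
    exact Ho.whiskerRight_injective_of_weq (s := Ho.arr M (Q.p W)) (Q.weq_p W)
      (whiskerRight_assoc_cell (Q.hoρ f) (Q.hoρ g)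
        (Q.hoρ h) (Q.hoρ l) (Q.hoρ (f ≫ g))
        (Q.hoρ (g ≫ h)) h₁ h₂ h₃ h₄ e)
  · intro X Y Z f₁ f₂ g₁ g₂ l₁ l₂ α β γ H₁ H₂ K₁ K₂ h₁ h₂ e
    exact Ho.whiskerRight_injective_of_weq (s := Ho.arr M (Q.p Z)) (Q.weq_p Z)
      (whiskerRight_naturality_cell (Q.hoρ f₁) (Q.hoρ f₂)
        (Q.hoρ g₁) (Q.hoρ g₂) (Q.hoρ l₁)
        (Q.hoρ l₂) (Q.cell_map₂_whiskerRight_p α) (Q.cell_map₂_whiskerRight_p β)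
        (Q.cell_map₂_whiskerRight_p γ) h₁ h₂ e)
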